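/- **Theorem 2.6.** Let $k$ be an algebraically closed field of characteristic $0$, let $p,q$ be distinct prime numbers, and let $H$ be a semisimple Hopf algebra over $k$ with $\dim_k H=p^2q^2$. Let $G(H)$ and $G(H^*)$ denote the groups of group-like elements of $H$ and of the dual Hopf algebra $H^*$. If $$\gcd(|G(H)|,|G(H^*)|)=p^2,$$ then there exist a group $G$ of order $p^2$, with group algebra $kG$, and a semisimple Yetter–Drinfeld Hopf algebra $R$ over $kG$ of dimension $q^2$ such that $H\cong R\#kG$ as Hopf algebras. Here, for a Hopf algebra $A$ over $k$, a Yetter–Drinfeld Hopf algebra over $A$ is a Hopf algebra in the braided category ${}^A_A\mathcal{YD}$ of left-left Yetter–Drinfeld modules over $A$, that is, of left $A$-modules that are left $A$-comodules $v\mapsto v_{-1}\otimes v_0$ with $h_1v_{-1}\otimes h_2\cdot v_0=(h_1\cdot v)_{-1}h_2\otimes (h_1\cdot v)_0$, the braiding being $v\otimes w\mapsto v_{-1}\cdot w\otimes v_0$; it is called semisimple if it is semisimple as an algebra. Write $\Delta_R(a)=a^1\otimes a^2$, and let $\varepsilon_R$ and $S_R$ be the counit and the antipode of $R$. The Radford biproduct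 $R\#A$ is the vector space $R\otimes A$ with the Hopf algebra structure given by $$(a\otimes g)(b\otimes h)=a(g_1\cdot b)\otimes g_2h,\qquad 1=1_R\otimes 1_A,$$ $$\Delta(a\otimes g)=\big(a^1\otimes (a^2)_{-1}g_1\big)\otimes\big((a^2)_0\otimes g_2\big),\qquad \varepsilon=\varepsilon_R\otimes\varepsilon_A,$$ $$S(a\otimes g)=\big(1\otimes S_A(a_{-1}g)\big)\big(S_R(a_0)\otimes 1\big).$$ -/

import Mathlib

open scoped TensorProduct

universe u v w x

noncomputable section

namespace HopfBiproduct

section Dual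

variable {k : Type u} {A : Type v} [Field k] [Ring A] [Algebra k A] [FiniteDimensional k A]

/-- The comultiplication of `A^*`: the transpose `A^* → (A ⊗ A)^*` of the multiplication, followed
by the canonical identification `(A ⊗ A)^* ≃ A^* ⊗ A^*` (`A` is finite-dimensional). -/
def dualComul : Module.Dual k A →ₗ[k] Module.Dual k A ⊗[k] Module.Dual k A :=
  (TensorProduct.dualDistribEquiv k A A).symm.toLinearMap ∘ₗ (LinearMap.mul' k A).dualMap

/-- `Δ(f) = ∑ f₁ ⊗ f₂` is characterized by `f (x * y) = ∑ f₁(x) f₂(y)`. -/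
theorem dualDistrib_dualComul (f : Module.Dual k A) (x y : A) :
    TensorProduct.dualDistrib k A A (dualComul f) (x ⊗ₜ[k] y) = f (x * y) := by
  have h : TensorProduct.dualDistribEquiv k A A (dualComul f)
      = (LinearMap.mul' k A).dualMap f :=
    LinearEquiv.apply_symm_apply _ _
  exact LinearMap.congr_fun h (x ⊗ₜ[k] y)

/-- Evaluation of a threefold tensor of functionals on threefold tensors. -/
def evalThree : Module.Dual k A ⊗[k] (Module.Dual k A ⊗[k] Module.Dual k A) ≃ₗ[k]
    Module.Dual k (A ⊗[k] (A ⊗[k] A)) :=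
  (TensorProduct.congr (LinearEquiv.refl k _) (TensorProduct.dualDistribEquiv k A A)).trans
    (TensorProduct.dualDistribEquiv k A (A ⊗[k] A))

theorem evalThree_tmul (f : Module.Dual k A) (t : Module.Dual k A ⊗[k] Module.Dual k A)
    (x y z : A) :
    evalThree (f ⊗ₜ[k] t) (x ⊗ₜ[k] (y ⊗ₜ[k] z))
      = f x * TensorProduct.dualDistrib k A A t (y ⊗ₜ[k] z) := by
  simp [evalThree, TensorProduct.dualDistribEquiv, TensorProduct.dualDistribEquivOfBasis]

theorem evalThree_assoc_tmul (s : Module.Dual k A ⊗[k] Module.Dual k A) (h : Module.Dual k A)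
    (x y z : A) :
    evalThree (TensorProduct.assoc k _ _ _ (s ⊗ₜ[k] h)) (x ⊗ₜ[k] (y ⊗ₜ[k] z))
      = TensorProduct.dualDistrib k A A s (x ⊗ₜ[k] y) * h z := by
  induction s with
  | zero => simp
  | tmul f g => simp [evalThree_tmul, mul_assoc]
  | add s t hs ht => simp only [TensorProduct.add_tmul, map_add, LinearMap.add_apply, hs, ht,
      add_mul]

/-- The coalgebra structure of the dual `A^*` of a finite-dimensional algebra `A`, with
comultiplication the transpose of the multiplication and counit the evaluation at `1`. For a
finite-dimensional Hopf algebra `H` it is the coalgebra underlying the dual Hopf algebra `H^*`. -/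
instance dualCoalgebra : Coalgebra k (Module.Dual k A) where
  comul := dualComul
  counit := Module.Dual.eval k A 1
  coassoc := by
    ext f
    apply evalThree.injective
    ext x y z
    have hl : ∀ t : Module.Dual k A ⊗[k] Module.Dual k A,
        evalThree (TensorProduct.assoc k _ _ _ (dualComul.rTensor _ t)) (x ⊗ₜ[k] (y ⊗ₜ[k] z))
          = TensorProduct.dualDistrib k A A t ((x * y) ⊗ₜ[k] z) := by
      intro t
      induction t with
      | zero => simp
      | tmul f g => simp [evalThree_assoc_tmul, dualDistrib_dualComul]
      | add s t hs ht => simp only [map_add, LinearMap.add_apply, hs, ht]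
    have hr : ∀ t : Module.Dual k A ⊗[k] Module.Dual k A,
        evalThree (dualComul.lTensor _ t) (x ⊗ₜ[k] (y ⊗ₜ[k] z))
          = TensorProduct.dualDistrib k A A t (x ⊗ₜ[k] (y * z)) := by
      intro t
      induction t with
      | zero => simp
      | tmul f g => simp [evalThree_tmul, dualDistrib_dualComul]
      | add s t hs ht => simp only [map_add, LinearMap.add_apply, hs, ht]
    have := (hl (dualComul f)).trans ((by simp [dualDistrib_dualComul, mul_assoc] :
      _ = _).trans (hr (dualComul f)).symm)
    simpa using this
  rTensor_counit_comp_comul := by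
    ext f
    apply (TensorProduct.lid k (Module.Dual k A)).injective
    ext y
    have h : ∀ t : Module.Dual k A ⊗[k] Module.Dual k A,
        TensorProduct.lid k (Module.Dual k A) ((Module.Dual.eval k A 1).rTensor _ t) y
          = TensorProduct.dualDistrib k A A t (1 ⊗ₜ[k] y) := by
      intro t
      induction t with
      | zero => simp
      | tmul f g => simp
      | add s t hs ht => simp only [map_add, LinearMap.add_apply, hs, ht]
    simpa [dualDistrib_dualComul] using h (dualComul f)
  lTensor_counit_comp_comul := by
    ext f
    apply (TensorProduct.rid k (Module.Dual k A)).injective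
    ext y
    have h : ∀ t : Module.Dual k A ⊗[k] Module.Dual k A,
        TensorProduct.rid k (Module.Dual k A) ((Module.Dual.eval k A 1).lTensor _ t) y
          = TensorProduct.dualDistrib k A A t (y ⊗ₜ[k] 1) := by
      intro t
      induction t with
      | zero => simp
      | tmul f g => simp [mul_comm]
      | add s t hs ht => simp only [map_add, LinearMap.add_apply, hs, ht]
    simpa [dualDistrib_dualComul] using h (dualComul f)

end Dual

section Middle

variable {k : Type*} [Field k] {X B C B' C' Y : Type*}
  [AddCommGroup X] [Module k X] [AddCommGroup B] [Module k B] [AddCommGroup C] [Module k C]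
  [AddCommGroup B'] [Module k B'] [AddCommGroup C'] [Module k C'] [AddCommGroup Y] [Module k Y]

/-- Apply `f : B ⊗ C → C' ⊗ B'` to the two middle factors of a fourfold tensor product:
`(x ⊗ b) ⊗ (c ⊗ y) ↦ (x ⊗ c') ⊗ (b' ⊗ y)`, where `f (b ⊗ c) = c' ⊗ b'` (summation understood). -/
def middle (f : B ⊗[k] C →ₗ[k] C' ⊗[k] B') :
    (X ⊗[k] B) ⊗[k] (C ⊗[k] Y) →ₗ[k] (X ⊗[k] C') ⊗[k] (B' ⊗[k] Y) :=
  (TensorProduct.assoc k X C' (B' ⊗[k] Y)).symm.toLinearMap ∘ₗ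
  ((TensorProduct.assoc k C' B' Y).toLinearMap.lTensor X) ∘ₗ
  ((f.rTensor Y).lTensor X) ∘ₗ
  ((TensorProduct.assoc k B C Y).symm.toLinearMap.lTensor X) ∘ₗ
  (TensorProduct.assoc k X B (C ⊗[k] Y)).toLinearMap

end Middle

/-- A (left-left) Yetter–Drinfeld module over the Hopf algebra `A`, on the vector space `V`: a left
`A`-module `h ⊗ v ↦ h · v` that is also a left `A`-comodule `v ↦ v₋₁ ⊗ v₀`, with
`h₁ v₋₁ ⊗ h₂ · v₀ = (h₁ · v)₋₁ h₂ ⊗ (h₁ · v)₀`. -/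
structure YetterDrinfeldModule (k : Type u) (A : Type v) (V : Type w) [Field k] [Ring A]
    [HopfAlgebra k A] [AddCommGroup V] [Module k V] where
  /-- The action of `A`; the `k`-structure induced by it is the given one. -/
  action : A →ₐ[k] Module.End k V
  /-- The coaction `v ↦ v₋₁ ⊗ v₀`. -/
  coaction : V →ₗ[k] A ⊗[k] V
  coaction_coassoc :
    (TensorProduct.assoc k A A V).toLinearMap ∘ₗ
        (Coalgebra.comul (R := k) (A := A)).rTensor V ∘ₗ coaction
      = coaction.lTensor A ∘ₗ coaction
  coaction_counit :
    (TensorProduct.lid k V).toLinearMap ∘ₗ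
        (Coalgebra.counit (R := k) (A := A)).rTensor V ∘ₗ coaction
      = LinearMap.id
  /-- The left side sends `h ⊗ v` to `h₁ v₋₁ ⊗ h₂ · v₀`. The right side sends it to
  `h₁ ⊗ (h₂ ⊗ v)`, to `h₁ ⊗ (v ⊗ h₂)`, to `h₁ · v ⊗ h₂`, to `((h₁ · v)₋₁ ⊗ (h₁ · v)₀) ⊗ h₂`, to
  `((h₁ · v)₋₁ ⊗ h₂) ⊗ (h₁ · v)₀` and finally to `(h₁ · v)₋₁ h₂ ⊗ (h₁ · v)₀`. -/
  compatibility :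
    TensorProduct.map (LinearMap.mul' k A) (TensorProduct.lift action.toLinearMap) ∘ₗ
        (TensorProduct.tensorTensorTensorComm k A A A V).toLinearMap ∘ₗ
        TensorProduct.map Coalgebra.comul coaction
      = (LinearMap.mul' k A).rTensor V ∘ₗ
        (TensorProduct.rightComm k A V A).toLinearMap ∘ₗ
        coaction.rTensor A ∘ₗ
        (TensorProduct.lift action.toLinearMap).rTensor A ∘ₗ
        (TensorProduct.assoc k A V A).symm.toLinearMap ∘ₗ
        (TensorProduct.comm k A V).toLinearMap.lTensor A ∘ₗ
        (TensorProduct.assoc k A A V).toLinearMap ∘ₗ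
        (Coalgebra.comul (R := k) (A := A)).rTensor V

namespace YetterDrinfeldModule

variable {k : Type u} {A : Type v} {V : Type w} [Field k] [Ring A] [HopfAlgebra k A]
  [AddCommGroup V] [Module k V] (M : YetterDrinfeldModule k A V)

/-- The action as a linear map, `h ⊗ v ↦ h · v`. -/
def act : A ⊗[k] V →ₗ[k] V := TensorProduct.lift M.action.toLinearMap

/-- The action of `A` on the tensor square: `h · (v ⊗ w) = h₁ · v ⊗ h₂ · w`. -/
def tensorAct : A ⊗[k] (V ⊗[k] V) →ₗ[k] V ⊗[k] V :=
  TensorProduct.map M.act M.act ∘ₗ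
    (TensorProduct.tensorTensorTensorComm k A A V V).toLinearMap ∘ₗ
    (Coalgebra.comul (R := k) (A := A)).rTensor (V ⊗[k] V)

/-- The coaction of `A` on the tensor square: `v ⊗ w ↦ v₋₁ w₋₁ ⊗ (v₀ ⊗ w₀)`. -/
def tensorCoact : V ⊗[k] V →ₗ[k] A ⊗[k] (V ⊗[k] V) :=
  (LinearMap.mul' k A).rTensor (V ⊗[k] V) ∘ₗ
    (TensorProduct.tensorTensorTensorComm k A V A V).toLinearMap ∘ₗ
    TensorProduct.map M.coaction M.coaction

/-- The braiding of the tensor square: `v ⊗ w ↦ v₋₁ · w ⊗ v₀`. -/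
def braiding : V ⊗[k] V →ₗ[k] V ⊗[k] V :=
  M.act.rTensor V ∘ₗ (TensorProduct.rightComm k A V V).toLinearMap ∘ₗ M.coaction.rTensor V

/-- `A ⊗ V → V ⊗ A`, `h ⊗ v ↦ h₁ · v ⊗ h₂`. -/
def actSwap : A ⊗[k] V →ₗ[k] V ⊗[k] A :=
  M.act.rTensor A ∘ₗ (TensorProduct.rightComm k A A V).toLinearMap ∘ₗ
    (Coalgebra.comul (R := k) (A := A)).rTensor V

/-- `V ⊗ A → A ⊗ V`, `v ⊗ h ↦ v₋₁ h ⊗ v₀`. -/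
def coactSwap : V ⊗[k] A →ₗ[k] A ⊗[k] V :=
  (LinearMap.mul' k A).rTensor V ∘ₗ (TensorProduct.rightComm k A V A).toLinearMap ∘ₗ
    M.coaction.rTensor A

end YetterDrinfeldModule

/-- The structure of a Hopf algebra in the braided category of Yetter–Drinfeld modules over `A`, on
the algebra and coalgebra `R`: multiplication, unit, comultiplication, counit and antipode are
`A`-linear and `A`-colinear, comultiplication and counit are multiplicative with respect to the
product `(r ⊗ r')(s ⊗ s') = r (r'₋₁ · s) ⊗ r'₀ s'` of `R ⊗ R` twisted by the braiding, and the
antipode is the convolution inverse of the identity. -/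
structure YetterDrinfeldHopfAlgebra (k : Type u) (A : Type v) (R : Type w) [Field k] [Ring A]
    [HopfAlgebra k A] [Ring R] [Algebra k R] [Coalgebra k R] extends
    YetterDrinfeldModule k A R where
  /-- `h · (r s) = (h₁ · r) (h₂ · s)` -/
  act_mul : toYetterDrinfeldModule.act ∘ₗ (LinearMap.mul' k R).lTensor A
    = LinearMap.mul' k R ∘ₗ toYetterDrinfeldModule.tensorAct
  act_one : ∀ h : A, action h 1 = Coalgebra.counit (R := k) h • (1 : R)
  /-- `ρ(r s) = r₋₁ s₋₁ ⊗ r₀ s₀` -/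
  coaction_mul : coaction ∘ₗ LinearMap.mul' k R
    = (LinearMap.mul' k R).lTensor A ∘ₗ toYetterDrinfeldModule.tensorCoact
  coaction_one : coaction 1 = 1 ⊗ₜ[k] 1
  /-- `Δ(h · r) = h₁ · r¹ ⊗ h₂ · r²` -/
  comul_act : Coalgebra.comul ∘ₗ toYetterDrinfeldModule.act
    = toYetterDrinfeldModule.tensorAct ∘ₗ (Coalgebra.comul (R := k) (A := R)).lTensor A
  counit_act : ∀ (h : A) (r : R), Coalgebra.counit (R := k) (action h r)
    = Coalgebra.counit (R := k) h * Coalgebra.counit (R := k) r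
  /-- `(r¹)₋₁ (r²)₋₁ ⊗ (r¹)₀ ⊗ (r²)₀ = r₋₁ ⊗ (r₀)¹ ⊗ (r₀)²` -/
  coaction_comul : toYetterDrinfeldModule.tensorCoact ∘ₗ Coalgebra.comul
    = (Coalgebra.comul (R := k) (A := R)).lTensor A ∘ₗ coaction
  /-- `r₋₁ ε(r₀) = ε(r) 1` -/
  coaction_counit_right : ∀ r : R,
    TensorProduct.rid k A ((Coalgebra.counit (R := k) (A := R)).lTensor A (coaction r))
      = Coalgebra.counit (R := k) r • (1 : A)
  /-- `Δ(r s) = r¹ ((r²)₋₁ · s¹) ⊗ (r²)₀ s²` -/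
  comul_mul : Coalgebra.comul ∘ₗ LinearMap.mul' k R
    = TensorProduct.map (LinearMap.mul' k R) (LinearMap.mul' k R) ∘ₗ
      middle toYetterDrinfeldModule.braiding ∘ₗ
      TensorProduct.map Coalgebra.comul Coalgebra.comul
  comul_one : Coalgebra.comul (R := k) (1 : R) = 1 ⊗ₜ[k] 1
  counit_mul : ∀ r s : R, Coalgebra.counit (R := k) (r * s)
    = Coalgebra.counit (R := k) r * Coalgebra.counit (R := k) s
  counit_one : Coalgebra.counit (R := k) (1 : R) = 1
  /-- The antipode of `R`. -/
  antipode : R →ₗ[k] R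
  antipode_act : ∀ (h : A) (r : R), antipode (action h r) = action h (antipode r)
  coaction_antipode : coaction ∘ₗ antipode = antipode.lTensor A ∘ₗ coaction
  /-- `S(r¹) r² = ε(r) 1` -/
  mul_antipode_rTensor_comul : LinearMap.mul' k R ∘ₗ antipode.rTensor R ∘ₗ Coalgebra.comul
    = Algebra.linearMap k R ∘ₗ Coalgebra.counit
  /-- `r¹ S(r²) = ε(r) 1` -/
  mul_antipode_lTensor_comul : LinearMap.mul' k R ∘ₗ antipode.lTensor R ∘ₗ Coalgebra.comul
    = Algebra.linearMap k R ∘ₗ Coalgebra.counit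

namespace YetterDrinfeldHopfAlgebra

variable {k : Type u} {A : Type v} {R : Type w} [Field k] [Ring A] [HopfAlgebra k A] [Ring R]
  [Algebra k R] [Coalgebra k R] (D : YetterDrinfeldHopfAlgebra k A R)

/-- The multiplication of the biproduct `R # A` (smash product) on the vector space `R ⊗ A`:
`(a ⊗ g)(b ⊗ h) = a (g₁ · b) ⊗ g₂ h`. Its unit is `1 ⊗ 1`. -/
def biproductMul : (R ⊗[k] A) ⊗[k] (R ⊗[k] A) →ₗ[k] R ⊗[k] A :=
  TensorProduct.map (LinearMap.mul' k R) (LinearMap.mul' k A) ∘ₗ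
    middle D.toYetterDrinfeldModule.actSwap

/-- The comultiplication of the biproduct `R # A` (smash coproduct):
`Δ(a ⊗ g) = (a¹ ⊗ (a²)₋₁ g₁) ⊗ ((a²)₀ ⊗ g₂)`. -/
def biproductComul : R ⊗[k] A →ₗ[k] (R ⊗[k] A) ⊗[k] (R ⊗[k] A) :=
  middle D.toYetterDrinfeldModule.coactSwap ∘ₗ
    TensorProduct.map Coalgebra.comul Coalgebra.comul

/-- The counit `ε_R ⊗ ε_A` of the biproduct `R # A`. -/
def biproductCounit (_D : YetterDrinfeldHopfAlgebra k A R) : R ⊗[k] A →ₗ[k] k :=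
  LinearMap.mul' k k ∘ₗ TensorProduct.map Coalgebra.counit Coalgebra.counit

/-- The antipode of the biproduct `R # A`: `S(a ⊗ g) = (1 ⊗ S(a₋₁ g)) (S_R(a₀) ⊗ 1)`. -/
def biproductAntipode : R ⊗[k] A →ₗ[k] R ⊗[k] A :=
  D.biproductMul ∘ₗ
    TensorProduct.map (TensorProduct.mk k R A 1 ∘ₗ HopfAlgebra.antipode k)
      ((TensorProduct.mk k R A).flip 1 ∘ₗ D.antipode) ∘ₗ
    D.toYetterDrinfeldModule.coactSwap

/-- An isomorphism of Hopf algebras from the biproduct `R # A` onto the Hopf algebra `H`: a linear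
bijection `R ⊗ A ≃ H` that carries the multiplication, unit, comultiplication, counit and antipode
of `R # A` to those of `H`. -/
structure BiproductIso (H : Type x) [Ring H] [HopfAlgebra k H] where
  /-- The underlying linear bijection. -/
  toLinearEquiv : R ⊗[k] A ≃ₗ[k] H
  map_mul : toLinearEquiv.toLinearMap ∘ₗ D.biproductMul
    = LinearMap.mul' k H ∘ₗ
      TensorProduct.map toLinearEquiv.toLinearMap toLinearEquiv.toLinearMap
  map_one : toLinearEquiv (1 ⊗ₜ[k] 1) = 1
  map_comul : TensorProduct.map toLinearEquiv.toLinearMap toLinearEquiv.toLinearMap ∘ₗ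
      D.biproductComul
    = Coalgebra.comul ∘ₗ toLinearEquiv.toLinearMap
  map_counit : Coalgebra.counit ∘ₗ toLinearEquiv.toLinearMap = D.biproductCounit
  map_antipode : toLinearEquiv.toLinearMap ∘ₗ D.biproductAntipode
    = HopfAlgebra.antipode k ∘ₗ toLinearEquiv.toLinearMap

end YetterDrinfeldHopfAlgebra

end HopfBiproduct

end

/-!
A nontrivial pair of a group-like element `g` and a character `f`, both of finite order, gives the
operator `x ↦ x₁ f(x₂) g` on `H`, which is `R_g T_f` with `R_g` the right multiplication by `g` and
`T_f = rightHit f`. The Galois maps `x ⊗ y ↦ x y₁ ⊗ y₂` and `x ⊗ y ↦ x₁ ⊗ x₂ y` of `H ⊗ H`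
intertwine `1 ⊗ R_g T_f` with `R_g ⊗ R_g T_f`, and `T_f ⊗ T_f` with `1 ⊗ T_f`. With `d = dim H` this
says `d tr(R_g T_f) = tr(R_g) tr(R_g T_f)` and `tr(T_f)² = d tr(T_f)`. An operator of finite order
with trace `d` is the identity, so `R_g T_f` is traceless (`trace_bihit_eq_zero`). Hence, when a
group `N` of group-like elements is killed by a group `Γ` of characters, the representation of
`N × Γ` on `H` has character `0` off the identity, and `|N| |Γ|` divides `d`
(`card_mul_card_dvd_finrank`).

The gcd hypothesis and Sylow's theorem provide a group `A` of group-like elements and a group `Γ` of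
characters, both of order `p²`. The part of `A` killed by `Γ` has order dividing `q²` by the
divisibility, and dividing `p²` since it lies in `A`, so it is trivial. Thus the pairing of `A` with
`Γ` is nondegenerate, and the Fourier transform on `Γ` provides a Hopf algebra map `π : H → kA` which
restricts to the identity of `kA` (`GroupSplitting.ofPairing`).

A Hopf algebra that splits over `kG` is a biproduct by Radford's theorem: `R` is the algebra of
right coinvariants, with the conjugation action of `G`, the coaction `r ↦ π(r₁) ⊗ r₂`, and the
comultiplication `r ↦ r₁ S(π(r₂)) ⊗ r₃`. Over a group algebra everything can be written with the
commuting projections `E_g` and `F_g` (`rdeg`, `ldeg`) onto the right and the left degree `g`, and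
the verification of the braided Hopf algebra axioms and of the isomorphism `r ⊗ g ↦ r g`
rests on the relation `E_g(r₁) ⊗ r₂ = r₁ ⊗ F_g(r₂)` (`sum_rdeg_tmul`). The algebra `R` is semisimple
because `E_1` is an `R`-bimodule projection of `H` onto `R`, and `dim R = d / p² = q²`.
-/

/-! ### Endomorphisms of finite order and their trace -/

section TraceFiniteOrder

/-- Roots of unity in a field of characteristic zero whose sum equals their number are all `1`:
embed the algebraic numbers of `k` into `ℂ` and compare real parts. -/
theorem Multiset.eq_one_of_sum_eq_card_of_pow_eq_one {k : Type*} [Field k] [CharZero k] {n : ℕ}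
    (hn : n ≠ 0) (s : Multiset k) (hs : ∀ r ∈ s, r ^ n = 1) (hsum : s.sum = s.card) :
    ∀ r ∈ s, r = 1 := by
  let K := algebraicClosure ℚ k
  have halg : ∀ r ∈ s, r ∈ K := fun r hr => by
    refine mem_algebraicClosure_iff.2 ⟨Polynomial.X ^ n - 1, ?_, by simp [hs r hr]⟩
    exact Polynomial.X_pow_sub_C_ne_zero (Nat.pos_of_ne_zero hn) (1 : ℚ)
  obtain ⟨t, rfl⟩ : ∃ t : Multiset K, t.map (algebraMap K k) = s :=
    ⟨s.attach.map fun r => ⟨r.1, halg r.1 r.2⟩, by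
      rw [Multiset.map_map]; exact Multiset.attach_map_val s⟩
  have : Algebra.IsAlgebraic ℚ K := by
    convert algebraicClosure.isAlgebraic ℚ k
    · rfl
    · exact Subsingleton.elim _ _
  let φ : K →ₐ[ℚ] ℂ := IsAlgClosed.lift
  have hinj := (algebraMap K k).injective
  have htsum : t.sum = t.card := hinj (by
    rw [map_multiset_sum, hsum, Multiset.card_map, map_natCast])
  have hnorm : ∀ z ∈ t, ‖φ z‖ = 1 := fun z hz => by
    refine Complex.norm_eq_one_of_pow_eq_one (n := n) ?_ hn
    rw [← map_pow, show z ^ n = 1 from hinj (by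
      rw [map_pow, hs _ (Multiset.mem_map_of_mem _ hz), map_one]), map_one]
  have hre : ∀ z ∈ t, 0 ≤ 1 - (φ z).re := fun z hz => by
    have := Complex.re_le_norm (φ z)
    rw [hnorm z hz] at this
    linarith
  have hsumre : (t.map fun z => 1 - (φ z).re).sum = 0 := by
    have h1 : (t.map fun z => (φ z).re).sum = t.card := by
      have h2 := congrArg (fun z => (φ z).re) htsum
      simp only [map_multiset_sum, map_natCast, Complex.natCast_re] at h2
      rw [← h2, ← Complex.reLm_coe, map_multiset_sum, Multiset.map_map]
      rfl
    rw [Multiset.sum_map_sub, h1]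
    simp
  intro r hr
  obtain ⟨z, hz, rfl⟩ := Multiset.mem_map.1 hr
  have hz0 : 1 - (φ z).re = 0 :=
    Multiset.all_zero_of_le_zero_le_of_sum_eq_zero (by
      intro x hx
      obtain ⟨y, hy, rfl⟩ := Multiset.mem_map.1 hx
      exact hre y hy) hsumre _ (Multiset.mem_map_of_mem (fun z => 1 - (φ z).re) hz)
  have hre1 : (φ z).re = 1 := by linarith
  have him : (φ z).im = 0 := by
    have h3 := Complex.sq_norm (φ z)
    rw [hnorm z hz, Complex.normSq_apply, hre1] at h3
    nlinarith
  have : φ z = φ 1 := by rw [map_one]; exact Complex.ext hre1 him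
  rw [φ.toRingHom.injective this, map_one]

/-- An endomorphism of finite order whose trace is the dimension is the identity. -/
theorem LinearMap.eq_one_of_pow_eq_one_of_trace_eq_finrank {k V : Type*} [Field k] [IsAlgClosed k]
    [CharZero k] [AddCommGroup V] [Module k V] [FiniteDimensional k V] (W : Module.End k V) {n : ℕ}
    (hn : n ≠ 0) (hW : W ^ n = 1) (htr : LinearMap.trace k V W = Module.finrank k V) : W = 1 := by
  rcases subsingleton_or_nontrivial V with hV | hV
  · exact Subsingleton.elim _ _
  have hpow : ∀ r ∈ W.charpoly.roots, r ^ n = 1 := fun r hr => by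
    have hr' : W.HasEigenvalue r :=
      (Module.End.hasEigenvalue_iff_isRoot_charpoly W r).2 (Polynomial.isRoot_of_mem_roots hr)
    obtain ⟨v, hv⟩ := hr'.exists_hasEigenvector
    have h1 := hv.pow_apply n
    rw [hW, Module.End.one_apply] at h1
    exact smul_left_injective k hv.2 (by simpa using h1.symm)
  have hsplit : W.charpoly.Splits := IsAlgClosed.splits _
  have hone := Multiset.eq_one_of_sum_eq_card_of_pow_eq_one hn W.charpoly.roots hpow (by
    rw [← Module.End.trace_eq_sum_roots_charpoly_of_splits hsplit, htr,
      ← hsplit.natDegree_eq_card_roots, LinearMap.charpoly_natDegree])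
  -- `1 + X + ⋯ + X ^ (n - 1)` takes the value `n ≠ 0` at the only eigenvalue `1`.
  have hunit : IsUnit (Polynomial.aeval W
      (∑ i ∈ Finset.range n, (Polynomial.X : Polynomial k) ^ i)) := by
    rw [← spectrum.zero_notMem_iff k, spectrum.map_polynomial_aeval_of_nonempty]
    · rintro ⟨r, hr, h0⟩
      have hr1 : r = 1 := hone r ((Polynomial.mem_roots (LinearMap.charpoly_monic W).ne_zero).2
        ((Module.End.mem_spectrum_iff_isRoot_charpoly W r).1 hr))
      subst hr1
      simp [Polynomial.eval_finsetSum] at h0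
      exact hn h0
    · exact spectrum.nonempty_of_isAlgClosed_of_finiteDimensional k W
  have hmul : Polynomial.aeval W (∑ i ∈ Finset.range n, (Polynomial.X : Polynomial k) ^ i) *
      (W - 1) = 0 := by
    have := Commute.geom_sum₂_mul (Commute.one_right W) n
    simp only [one_pow, mul_one, hW, sub_self] at this
    simpa using this
  exact sub_eq_zero.1 (hunit.mul_right_eq_zero.1 hmul)

end TraceFiniteOrder

/-! ### The operators of a functional on a coalgebra -/

section HitOperators

variable {k : Type u} {C : Type v} [Field k] [AddCommGroup C] [Module k C] [Coalgebra k C]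

open Coalgebra

/-- The operator `c ↦ c₁ ξ(c₂)` of a functional `ξ` on a coalgebra. -/
noncomputable def rightHit (ξ : Module.Dual k C) : C →ₗ[k] C :=
  (TensorProduct.rid k C).toLinearMap ∘ₗ ξ.lTensor C ∘ₗ comul

/-- The operator `c ↦ ξ(c₁) c₂` of a functional `ξ` on a coalgebra. -/
noncomputable def leftHit (ξ : Module.Dual k C) : C →ₗ[k] C :=
  (TensorProduct.lid k C).toLinearMap ∘ₗ ξ.rTensor C ∘ₗ comul

theorem rightHit_eq_sum (ξ : Module.Dual k C) {ι : Type*} {c : C} (r : Repr k c ι) :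
    rightHit ξ c = ∑ i ∈ r.index, ξ (r.right i) • r.left i := by
  simp [rightHit, ← r.eq]

theorem leftHit_eq_sum (ξ : Module.Dual k C) {ι : Type*} {c : C} (r : Repr k c ι) :
    leftHit ξ c = ∑ i ∈ r.index, ξ (r.left i) • r.right i := by
  simp [leftHit, ← r.eq]

theorem rightHit_counit : rightHit (counit (R := k) (A := C)) = LinearMap.id := by
  ext c; simp [rightHit]

theorem leftHit_counit : leftHit (counit (R := k) (A := C)) = LinearMap.id := by
  ext c; simp [leftHit]

theorem counit_rightHit (ξ : Module.Dual k C) (c : C) : counit (R := k) (rightHit ξ c) = ξ c := by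
  conv_rhs => rw [← sum_counit_smul (ℛ k c)]
  simp [rightHit_eq_sum ξ (ℛ k c), mul_comm]

theorem counit_leftHit (ξ : Module.Dual k C) (c : C) : counit (R := k) (leftHit ξ c) = ξ c := by
  have h := congrArg ξ (LinearMap.congr_fun (rightHit_counit (k := k) (C := C)) c)
  rw [rightHit_eq_sum _ (ℛ k c)] at h
  simpa [leftHit_eq_sum ξ (ℛ k c), mul_comm] using h

theorem comul_rightHit (ξ : Module.Dual k C) (c : C) :
    comul (R := k) (rightHit ξ c) = (rightHit ξ).lTensor C (comul c) := by
  have h1 : ∀ t : C ⊗[k] C, comul (R := k) (TensorProduct.rid k C (ξ.lTensor C t)) =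
      ((TensorProduct.rid k C).toLinearMap ∘ₗ ξ.lTensor C).lTensor C
        (TensorProduct.assoc k C C C (comul.rTensor C t)) := by
    intro t
    induction t with
    | zero => simp
    | add s t hs ht => simp only [map_add, hs, ht]
    | tmul a b =>
      have h2 : ∀ s : C ⊗[k] C, ξ b • s =
          ((TensorProduct.rid k C).toLinearMap ∘ₗ ξ.lTensor C).lTensor C
            (TensorProduct.assoc k C C C (s ⊗ₜ[k] b)) := by
        intro s
        induction s with
        | zero => simp
        | add s t hs ht => simp only [smul_add, TensorProduct.add_tmul, map_add, hs, ht]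
        | tmul x y => simp
      simpa using h2 (comul a)
  refine (h1 (comul c)).trans ?_
  rw [coassoc_apply, ← LinearMap.comp_apply, ← LinearMap.lTensor_comp]
  rfl

theorem comul_leftHit (ξ : Module.Dual k C) (c : C) :
    comul (R := k) (leftHit ξ c) = (leftHit ξ).rTensor C (comul c) := by
  have h1 : ∀ t : C ⊗[k] C, comul (R := k) (TensorProduct.lid k C (ξ.rTensor C t)) =
      ((TensorProduct.lid k C).toLinearMap ∘ₗ ξ.rTensor C).rTensor C
        ((TensorProduct.assoc k C C C).symm (comul.lTensor C t)) := by
    intro t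
    induction t with
    | zero => simp
    | add s t hs ht => simp only [map_add, hs, ht]
    | tmul a b =>
      have h2 : ∀ s : C ⊗[k] C, ξ a • s =
          ((TensorProduct.lid k C).toLinearMap ∘ₗ ξ.rTensor C).rTensor C
            ((TensorProduct.assoc k C C C).symm (a ⊗ₜ[k] s)) := by
        intro s
        induction s with
        | zero => simp
        | add s t hs ht => simp only [smul_add, TensorProduct.tmul_add, map_add, hs, ht]
        | tmul x y => simp [TensorProduct.smul_tmul']
      simpa using h2 (comul b)
  refine (h1 (comul c)).trans ?_
  rw [coassoc_symm_apply, ← LinearMap.comp_apply, ← LinearMap.rTensor_comp]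
  rfl

/-- `c₁ ξ(c₂) ⊗ c₃` is read off from `c₁ ⊗ (c₂ ⊗ c₃)` as well as from `(c₁ ⊗ c₂) ⊗ c₃`. -/
theorem rTensor_rightHit_comul (ξ : Module.Dual k C) (c : C) :
    (rightHit ξ).rTensor C (comul c) = (leftHit ξ).lTensor C (comul (R := k) c) := by
  have h1 : ∀ t : C ⊗[k] (C ⊗[k] C),
      ((TensorProduct.rid k C).toLinearMap ∘ₗ ξ.lTensor C).rTensor C
          ((TensorProduct.assoc k C C C).symm t) =
        ((TensorProduct.lid k C).toLinearMap ∘ₗ ξ.rTensor C).lTensor C t := by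
    intro t
    have h2 : ∀ s : (C ⊗[k] C) ⊗[k] C,
        ((TensorProduct.rid k C).toLinearMap ∘ₗ ξ.lTensor C).rTensor C s =
          ((TensorProduct.lid k C).toLinearMap ∘ₗ ξ.rTensor C).lTensor C
            (TensorProduct.assoc k C C C s) := by
      intro s
      induction s with
      | zero => simp
      | add s t hs ht => simp only [map_add, hs, ht]
      | tmul s z =>
        induction s with
        | zero => simp
        | add s t hs ht => simp only [map_add, TensorProduct.add_tmul, hs, ht]
        | tmul x y => simp [TensorProduct.smul_tmul]
    rw [h2, LinearEquiv.apply_symm_apply]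
  have h2 := h1 (comul.lTensor C (comul c))
  rw [coassoc_symm_apply, ← LinearMap.comp_apply, ← LinearMap.rTensor_comp,
    ← LinearMap.comp_apply (LinearMap.lTensor C _), ← LinearMap.lTensor_comp] at h2
  exact h2

theorem leftHit_rightHit (ξ η : Module.Dual k C) (c : C) :
    leftHit ξ (rightHit η c) = rightHit η (leftHit ξ c) := by
  have h : ∀ t : C ⊗[k] C, TensorProduct.lid k C (ξ.rTensor C ((rightHit η).lTensor C t)) =
      rightHit η (TensorProduct.lid k C (ξ.rTensor C t)) := by
    intro t
    induction t with
    | zero => simp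
    | add s t hs ht => simp only [map_add, hs, ht]
    | tmul a b => simp
  change TensorProduct.lid k C (ξ.rTensor C (comul (rightHit η c))) = _
  rw [comul_rightHit, h]
  rfl

theorem rightHit_rightHit (ξ η : Module.Dual k C) (c : C) :
    rightHit ξ (rightHit η c) = rightHit (ξ ∘ₗ rightHit η) c := by
  change TensorProduct.rid k C (ξ.lTensor C (comul (rightHit η c))) = _
  rw [comul_rightHit, ← LinearMap.comp_apply (ξ.lTensor C), ← LinearMap.lTensor_comp]
  rfl

theorem leftHit_leftHit (ξ η : Module.Dual k C) (c : C) :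
    leftHit ξ (leftHit η c) = leftHit (ξ ∘ₗ leftHit η) c := by
  change TensorProduct.lid k C (ξ.rTensor C (comul (leftHit η c))) = _
  rw [comul_leftHit, ← LinearMap.comp_apply (ξ.rTensor C), ← LinearMap.rTensor_comp]
  rfl

theorem comp_leftHit (ξ η : Module.Dual k C) : ξ ∘ₗ leftHit η = η ∘ₗ rightHit ξ := by
  ext c
  simp [leftHit_eq_sum η (ℛ k c), rightHit_eq_sum ξ (ℛ k c), mul_comm]

theorem IsGroupLikeElem.rightHit {g : C} (hg : IsGroupLikeElem k g) (ξ : Module.Dual k C) :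
    rightHit ξ g = ξ g • g := by
  simp [_root_.rightHit, hg.comul_eq_tmul_self]

theorem IsGroupLikeElem.leftHit {g : C} (hg : IsGroupLikeElem k g) (ξ : Module.Dual k C) :
    leftHit ξ g = ξ g • g := by
  simp [_root_.leftHit, hg.comul_eq_tmul_self]

end HitOperators

/-! ### Characters of a Hopf algebra -/

section Characters

variable {k : Type u} {H : Type v} [Field k] [Ring H] [HopfAlgebra k H]

open Coalgebra WithConv

/-- The characters of a Hopf algebra form a group under convolution, `f⁻¹ = f ∘ S`. -/
noncomputable instance characterGroup : Group (WithConv (H →ₐ[k] k)) where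
  inv f := toConv (AlgHom.ofLinearMap (f.ofConv.toLinearMap ∘ₗ HopfAlgebra.antipode k) (by simp)
    (fun x y => by simp [HopfAlgebra.antipode_mul_antidistrib, mul_comm]))
  inv_mul_cancel f := by
    apply WithConv.ofConv_injective
    ext x
    change (_ * f) x = (1 : WithConv (H →ₐ[k] k)) x
    rw [AlgHom.convMul_apply, ← (ℛ k x).eq, AlgHom.convOne_apply]
    simp only [map_sum, Algebra.TensorProduct.lift_tmul]
    have h := congrArg f.ofConv (HopfAlgebra.sum_antipode_mul_eq_algebraMap_counit (ℛ k x))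
    rw [map_sum, AlgHom.commutes] at h
    simp only [map_mul] at h
    exact h

theorem character_mul_apply (f g : WithConv (H →ₐ[k] k)) {ι : Type*} {x : H} (r : Repr k x ι) :
    (f * g).ofConv x = ∑ i ∈ r.index, f.ofConv (r.left i) * g.ofConv (r.right i) := by
  change (f * g) x = _
  rw [AlgHom.convMul_apply, ← r.eq]
  simp

theorem character_mul_groupLike (f g : WithConv (H →ₐ[k] k)) (x : GroupLike k H) :
    (f * g).ofConv x.val = f.ofConv x.val * g.ofConv x.val := by
  change (f * g) x.val = _
  rw [AlgHom.convMul_apply, x.2.comul_eq_tmul_self]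
  simp

/-- The group-like elements of the dual `H^*` are the characters of `H`. -/
noncomputable def groupLikeDualEquiv [FiniteDimensional k H] :
    GroupLike k (Module.Dual k H) ≃ WithConv (H →ₐ[k] k) where
  toFun f := toConv (AlgHom.ofLinearMap f.val f.2.counit_eq_one (fun x y => by
    rw [← HopfBiproduct.dualDistrib_dualComul]
    have h : HopfBiproduct.dualComul f.val = f.val ⊗ₜ[k] f.val := f.2.comul_eq_tmul_self
    rw [h]
    simp))
  invFun f := ⟨f.ofConv.toLinearMap, map_one f.ofConv, by
    apply (TensorProduct.dualDistribEquiv k H H).injective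
    refine TensorProduct.ext' fun x y => ?_
    refine (HopfBiproduct.dualDistrib_dualComul _ x y).trans ?_
    change _ = TensorProduct.dualDistrib k H H _ _
    simp⟩
  left_inv f := rfl
  right_inv f := rfl

/-- The operator `h ↦ h₁ f(h₂)` of a character `f`, as an algebra endomorphism. -/
noncomputable def characterHit (f : H →ₐ[k] k) : H →ₐ[k] H :=
  (Algebra.TensorProduct.rid k k H).toAlgHom.comp
    ((Algebra.TensorProduct.map (AlgHom.id k H) f).comp (Bialgebra.comulAlgHom k H))

theorem characterHit_apply (f : H →ₐ[k] k) (x : H) :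
    characterHit f x = rightHit f.toLinearMap x := rfl

theorem characterHit_one (x : H) :
    characterHit (1 : WithConv (H →ₐ[k] k)).ofConv x = x :=
  LinearMap.congr_fun (rightHit_counit (k := k) (C := H)) x

theorem characterHit_mul (f g : WithConv (H →ₐ[k] k)) (x : H) :
    characterHit (f * g).ofConv x = characterHit f.ofConv (characterHit g.ofConv x) := by
  simp only [characterHit_apply]
  rw [rightHit_rightHit]
  congr 2
  ext y
  simp [character_mul_apply f g (ℛ k y), rightHit_eq_sum _ (ℛ k y), mul_comm]

theorem characterHit_groupLike (f : H →ₐ[k] k) (g : GroupLike k H) :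
    characterHit f g.val = f g.val • g.val :=
  g.2.rightHit f.toLinearMap

theorem comul_characterHit (f : H →ₐ[k] k) (x : H) :
    comul (R := k) (characterHit f x) =
      Algebra.TensorProduct.map (AlgHom.id k H) (characterHit f) (comul x) :=
  comul_rightHit f.toLinearMap x

theorem counit_characterHit (f : H →ₐ[k] k) (x : H) :
    counit (R := k) (characterHit f x) = f x :=
  counit_rightHit f.toLinearMap x

/-- An algebra map precomposed with the antipode is its convolution inverse. -/
theorem AlgHom.comp_antipode_convInverse {B : Type*} [Ring B] [Algebra k B] (T : H →ₐ[k] B) :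
    toConv (T.toLinearMap ∘ₗ HopfAlgebra.antipode k) * toConv T.toLinearMap = 1 ∧
    toConv T.toLinearMap * toConv (T.toLinearMap ∘ₗ HopfAlgebra.antipode k) = 1 := by
  have hone : toConv (T.toLinearMap ∘ₗ (1 : WithConv (H →ₗ[k] H)).ofConv) = 1 := by
    ext x
    simp [LinearMap.convOne_def]
  have h1 := LinearMap.algHom_comp_convMul_distrib T (toConv (HopfAlgebra.antipode k (A := H)))
    (toConv LinearMap.id)
  have h2 := LinearMap.algHom_comp_convMul_distrib T (toConv LinearMap.id)
    (toConv (HopfAlgebra.antipode k (A := H)))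
  rw [LinearMap.antipode_mul_id] at h1
  rw [LinearMap.id_mul_antipode] at h2
  rw [h1] at hone
  refine ⟨hone, ?_⟩
  rw [← h1, h2] at hone
  exact hone

end Characters

/-! ### Traces of the translation operators -/

section Traces

variable {k : Type u} {H : Type v} [Field k] [Ring H] [HopfAlgebra k H]

open Coalgebra WithConv

/-- The Galois map `x ⊗ y ↦ x y₁ ⊗ y₂`. -/
noncomputable def galoisRight (k : Type u) (H : Type v) [Field k] [Ring H] [HopfAlgebra k H] :
    H ⊗[k] H →ₗ[k] H ⊗[k] H :=
  TensorProduct.lift ((LinearMap.mul k (H ⊗[k] H)).compl₁₂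
    ((TensorProduct.mk k H H).flip 1) comul)

/-- The Galois map `x ⊗ y ↦ x₁ ⊗ x₂ y`. -/
noncomputable def galoisLeft (k : Type u) (H : Type v) [Field k] [Ring H] [HopfAlgebra k H] :
    H ⊗[k] H →ₗ[k] H ⊗[k] H :=
  TensorProduct.lift ((LinearMap.mul k (H ⊗[k] H)).compl₁₂ comul (TensorProduct.mk k H H 1))

theorem galoisRight_tmul (x y : H) : galoisRight k H (x ⊗ₜ y) = (x ⊗ₜ 1) * comul y := by
  simp [galoisRight]

theorem galoisLeft_tmul (x y : H) : galoisLeft k H (x ⊗ₜ y) = comul x * (1 ⊗ₜ y) := by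
  simp [galoisLeft]

theorem galoisRight_surjective : Function.Surjective (galoisRight k H) := by
  -- `S(y₁) ⊗ y₂` is mapped to `1 ⊗ y`.
  have key : ∀ y : H,
      ((galoisRight k H) ∘ₗ (HopfAlgebra.antipode k).rTensor H) (comul y) = 1 ⊗ₜ y := by
    intro y
    have h1 : ∀ t : H ⊗[k] H, ((galoisRight k H) ∘ₗ (HopfAlgebra.antipode k).rTensor H) t =
        (LinearMap.mul' k H ∘ₗ (HopfAlgebra.antipode k).rTensor H).rTensor H
          ((TensorProduct.assoc k H H H).symm (comul.lTensor H t)) := by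
      intro t
      induction t with
      | zero => simp
      | add s t hs ht => simp only [map_add, hs, ht]
      | tmul a b =>
        have h2 : ∀ s : H ⊗[k] H, ((HopfAlgebra.antipode k a) ⊗ₜ[k] (1 : H)) * s =
            (LinearMap.mul' k H ∘ₗ (HopfAlgebra.antipode k).rTensor H).rTensor H
              ((TensorProduct.assoc k H H H).symm (a ⊗ₜ[k] s)) := by
          intro s
          induction s with
          | zero => simp
          | add s t hs ht => simp only [mul_add, TensorProduct.tmul_add, map_add, hs, ht]
          | tmul x y => simp
        simpa [galoisRight_tmul] using h2 (comul b)
    rw [h1, coassoc_symm_apply, ← LinearMap.comp_apply, ← LinearMap.rTensor_comp,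
      LinearMap.comp_assoc, HopfAlgebra.mul_antipode_rTensor_comul, LinearMap.rTensor_comp,
      LinearMap.comp_apply, rTensor_counit_comul]
    simp
  rw [← LinearMap.range_eq_top, eq_top_iff, ← TensorProduct.span_tmul_eq_top, Submodule.span_le]
  rintro _ ⟨x, y, rfl⟩
  refine ⟨(LinearMap.mulLeft k x).rTensor H ((HopfAlgebra.antipode k).rTensor H (comul y)), ?_⟩
  have h : ∀ t : H ⊗[k] H, galoisRight k H ((LinearMap.mulLeft k x).rTensor H t) =
      (x ⊗ₜ 1) * galoisRight k H t := by
    intro t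
    induction t with
    | zero => simp
    | add s t hs ht => simp only [map_add, mul_add, hs, ht]
    | tmul a b => simp [galoisRight_tmul, ← mul_assoc]
  rw [h, ← LinearMap.comp_apply (galoisRight k H), key]
  simp

theorem galoisLeft_surjective : Function.Surjective (galoisLeft k H) := by
  -- `y₁ ⊗ S(y₂)` is mapped to `y ⊗ 1`.
  have key : ∀ y : H,
      ((galoisLeft k H) ∘ₗ (HopfAlgebra.antipode k).lTensor H) (comul y) = y ⊗ₜ 1 := by
    intro y
    have h1 : ∀ t : H ⊗[k] H, ((galoisLeft k H) ∘ₗ (HopfAlgebra.antipode k).lTensor H) t =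
        (LinearMap.mul' k H ∘ₗ (HopfAlgebra.antipode k).lTensor H).lTensor H
          ((TensorProduct.assoc k H H H) (comul.rTensor H t)) := by
      intro t
      induction t with
      | zero => simp
      | add s t hs ht => simp only [map_add, hs, ht]
      | tmul a b =>
        have h2 : ∀ s : H ⊗[k] H, s * ((1 : H) ⊗ₜ[k] (HopfAlgebra.antipode k b)) =
            (LinearMap.mul' k H ∘ₗ (HopfAlgebra.antipode k).lTensor H).lTensor H
              ((TensorProduct.assoc k H H H) (s ⊗ₜ[k] b)) := by
          intro s
          induction s with
          | zero => simp
          | add s t hs ht => simp only [add_mul, TensorProduct.add_tmul, map_add, hs, ht]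
          | tmul x y => simp
        simpa [galoisLeft_tmul] using h2 (comul a)
    rw [h1, coassoc_apply, ← LinearMap.comp_apply, ← LinearMap.lTensor_comp,
      LinearMap.comp_assoc, HopfAlgebra.mul_antipode_lTensor_comul, LinearMap.lTensor_comp,
      LinearMap.comp_apply, lTensor_counit_comul]
    simp
  rw [← LinearMap.range_eq_top, eq_top_iff, ← TensorProduct.span_tmul_eq_top, Submodule.span_le]
  rintro _ ⟨x, y, rfl⟩
  refine ⟨(LinearMap.mulRight k y).lTensor H ((HopfAlgebra.antipode k).lTensor H (comul x)), ?_⟩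
  have h : ∀ t : H ⊗[k] H, galoisLeft k H ((LinearMap.mulRight k y).lTensor H t) =
      galoisLeft k H t * (1 ⊗ₜ y) := by
    intro t
    induction t with
    | zero => simp
    | add s t hs ht => simp only [map_add, add_mul, hs, ht]
    | tmul a b => simp [galoisLeft_tmul, mul_assoc]
  rw [h, ← LinearMap.comp_apply (galoisLeft k H), key]
  simp

/-- Endomorphisms intertwined by a surjection of a finite-dimensional space onto itself have the
same trace. -/
theorem LinearMap.trace_eq_of_comp_eq_comp {k V : Type*} [Field k] [AddCommGroup V] [Module k V]
    [FiniteDimensional k V] {β A B : V →ₗ[k] V} (hβ : Function.Surjective β)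
    (h : β ∘ₗ A = B ∘ₗ β) : LinearMap.trace k V A = LinearMap.trace k V B := by
  let e := LinearEquiv.ofBijective β ⟨LinearMap.injective_iff_surjective.2 hβ, hβ⟩
  have : B = e.conj A := by
    ext x
    obtain ⟨y, rfl⟩ := hβ x
    have h1 : e.symm (β y) = y := e.symm_apply_apply y
    rw [LinearEquiv.conj_apply]
    simp only [LinearMap.comp_apply, LinearEquiv.coe_coe, h1]
    exact (LinearMap.congr_fun h y).symm
  rw [this, LinearMap.trace_conj']

/-- The operator `x ↦ f(x₂) x₁ g` of a group-like element `g` and a character `f`. -/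
noncomputable def bihit (g : GroupLike k H) (f : H →ₐ[k] k) : H →ₗ[k] H :=
  LinearMap.mulRight k g.val ∘ₗ (characterHit f).toLinearMap

theorem bihit_apply (g : GroupLike k H) (f : H →ₐ[k] k) (x : H) :
    bihit g f x = characterHit f x * g.val := rfl

variable [FiniteDimensional k H]

/-- `galoisRight` intertwines `1 ⊗ W` with `R_g ⊗ W`, for `W = bihit g f` and `R_g` the right
multiplication by `g`. -/
theorem trace_bihit_mul_finrank (g : GroupLike k H) (f : H →ₐ[k] k) :
    Module.finrank k H * LinearMap.trace k H (bihit g f) =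
      LinearMap.trace k H (LinearMap.mulRight k g.val) * LinearMap.trace k H (bihit g f) := by
  have h : galoisRight k H ∘ₗ TensorProduct.map LinearMap.id (bihit g f) =
      TensorProduct.map (LinearMap.mulRight k g.val) (bihit g f) ∘ₗ galoisRight k H := by
    refine TensorProduct.ext' fun x y => ?_
    have h1 : ∀ s : H ⊗[k] H, x ⊗ₜ[k] (1 : H) *
        (Algebra.TensorProduct.map (AlgHom.id k H) (characterHit f) s * (g.val ⊗ₜ[k] g.val)) =
        TensorProduct.map (LinearMap.mulRight k g.val) (bihit g f) (x ⊗ₜ[k] (1 : H) * s) := by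
      intro s
      induction s with
      | zero => simp
      | add s t hs ht => simp only [map_add, add_mul, mul_add, hs, ht]
      | tmul a b => simp [bihit_apply, mul_assoc]
    simp only [LinearMap.comp_apply, TensorProduct.map_tmul, LinearMap.id_apply, galoisRight_tmul]
    rw [← h1, bihit_apply, Bialgebra.comul_mul, comul_characterHit, g.2.comul_eq_tmul_self]
  have := LinearMap.trace_eq_of_comp_eq_comp galoisRight_surjective h
  rwa [LinearMap.trace_tensorProduct', LinearMap.trace_tensorProduct', LinearMap.trace_id] at this

/-- `galoisLeft` intertwines `T ⊗ T` with `1 ⊗ T`, for `T = characterHit f`. -/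
theorem trace_characterHit_mul_finrank (f : H →ₐ[k] k) :
    Module.finrank k H * LinearMap.trace k H (characterHit f).toLinearMap =
      LinearMap.trace k H (characterHit f).toLinearMap *
        LinearMap.trace k H (characterHit f).toLinearMap := by
  have h : galoisLeft k H ∘ₗ
        TensorProduct.map (characterHit f).toLinearMap (characterHit f).toLinearMap =
      TensorProduct.map LinearMap.id (characterHit f).toLinearMap ∘ₗ galoisLeft k H := by
    refine TensorProduct.ext' fun x y => ?_
    change galoisLeft k H (characterHit f x ⊗ₜ characterHit f y) =
      Algebra.TensorProduct.map (AlgHom.id k H) (characterHit f) (galoisLeft k H (x ⊗ₜ y))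
    rw [galoisLeft_tmul, galoisLeft_tmul, comul_characterHit, map_mul]
    simp
  have := LinearMap.trace_eq_of_comp_eq_comp galoisLeft_surjective h
  rw [LinearMap.trace_tensorProduct', LinearMap.trace_tensorProduct', LinearMap.trace_id] at this
  exact this.symm

variable [IsAlgClosed k] [CharZero k]

/-- The operators of a pair `(g, f) ≠ (1, ε)` of elements of finite order are traceless. -/
theorem trace_bihit_eq_zero (g : GroupLike k H) (f : WithConv (H →ₐ[k] k)) (hg : IsOfFinOrder g)
    (hf : IsOfFinOrder f) (hne : ¬ (g = 1 ∧ f = 1)) :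
    LinearMap.trace k H (bihit g f.ofConv) = 0 := by
  by_cases hg1 : g = 1
  · have hf1 : f ≠ 1 := fun h => hne ⟨hg1, h⟩
    have hb : bihit g f.ofConv = (characterHit f.ofConv).toLinearMap := by
      ext x; simp [bihit_apply, hg1]
    rw [hb]
    by_contra h0
    have htr := (mul_right_cancel₀ h0 (trace_characterHit_mul_finrank f.ofConv)).symm
    obtain ⟨n, hn, hfn⟩ := isOfFinOrder_iff_pow_eq_one.1 hf
    have hpow : ∀ m : ℕ, (characterHit f.ofConv).toLinearMap ^ m =
        (characterHit (f ^ m).ofConv).toLinearMap := by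
      intro m
      induction m with
      | zero => ext x; simp [characterHit_one]
      | succ m ih => ext x; rw [pow_succ, ih, pow_succ]; simp [characterHit_mul]
    have h1 := LinearMap.eq_one_of_pow_eq_one_of_trace_eq_finrank
      ((characterHit f.ofConv).toLinearMap : Module.End k H) hn.ne' (by
        rw [hpow, hfn]; ext x; simp [characterHit_one]) htr
    apply hf1
    apply WithConv.ofConv_injective
    ext x
    rw [← counit_characterHit, show characterHit f.ofConv x = x from LinearMap.congr_fun h1 x]
    rfl
  · by_contra h0
    have htr := (mul_right_cancel₀ h0 (trace_bihit_mul_finrank g f.ofConv)).symm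
    obtain ⟨n, hn, hgn⟩ := isOfFinOrder_iff_pow_eq_one.1 hg
    have h1 := LinearMap.eq_one_of_pow_eq_one_of_trace_eq_finrank
      (LinearMap.mulRight k g.val : Module.End k H) hn.ne' (by
        rw [LinearMap.pow_mulRight, ← GroupLike.val_pow, hgn]; ext x; simp) htr
    apply hg1
    ext
    simpa using LinearMap.congr_fun h1 1

/-- A finite group of group-like elements killed by a finite group of characters: the product of
the two acts on `H` by `x ↦ f(x₂) x₁ g⁻¹` with traceless nontrivial operators, so its order divides
the dimension. -/
theorem card_mul_card_dvd_finrank (N : Subgroup (GroupLike k H))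
    (Γ : Subgroup (WithConv (H →ₐ[k] k))) [Finite N] [Finite Γ]
    (hN : ∀ g ∈ N, ∀ f ∈ Γ, f.ofConv g.val = 1) :
    Nat.card N * Nat.card Γ ∣ Module.finrank k H := by
  classical
  have := Fintype.ofFinite N
  have := Fintype.ofFinite Γ
  let ρ : Representation k (N × Γ) H :=
    { toFun := fun a => bihit (a.1⁻¹).val a.2.val.ofConv
      map_one' := by
        ext x
        simp [bihit_apply, characterHit_one]
      map_mul' := fun a b => by
        ext x
        have h1 : a.2.val.ofConv (HopfAlgebra.antipode k b.1.val.val) = 1 :=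
          hN _ (b.1⁻¹).2 _ a.2.2
        have h2 : characterHit a.2.val.ofConv (HopfAlgebra.antipode k b.1.val.val) =
            HopfAlgebra.antipode k b.1.val.val := by
          have := characterHit_groupLike a.2.val.ofConv (b.1⁻¹).val
          simpa [h1] using this
        simp [bihit_apply, characterHit_mul, h2, mul_assoc] }
  have hcard : ((Fintype.card (N × Γ) : ℕ) : k) ≠ 0 := Nat.cast_ne_zero.2 Fintype.card_ne_zero
  have : Invertible (Fintype.card (N × Γ) : k) := invertibleOfNonzero hcard
  -- The trace of the averaging projector is the dimension of the invariants, and only the identity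
  -- contributes to it.
  have h1 := ρ.isProj_averageMap.trace
  have h2 : LinearMap.trace k H ρ.averageMap =
      ⅟(Fintype.card (N × Γ) : k) * Module.finrank k H := by
    have h3 : ρ.averageMap = ⅟(Fintype.card (N × Γ) : k) • ∑ a, ρ a := by
      simp [Representation.averageMap, GroupAlgebra.average, map_sum]
    rw [h3, map_smul, map_sum, Finset.sum_eq_single 1, map_one, smul_eq_mul]
    · congr 1
      exact LinearMap.trace_id k H
    · intro a _ ha
      refine trace_bihit_eq_zero _ _ ?_ ?_ ?_
      · exact N.subtype.isOfFinOrder (isOfFinOrder_of_finite (a.1⁻¹))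
      · exact Γ.subtype.isOfFinOrder (isOfFinOrder_of_finite a.2)
      · rintro ⟨h, h'⟩
        apply ha
        exact Prod.ext (by simpa using h) (Subtype.ext h')
    · simp
  rw [h2] at h1
  refine ⟨Module.finrank k ρ.invariants, ?_⟩
  have h4 : (Module.finrank k H : k) =
      (Fintype.card (N × Γ) : k) * Module.finrank k ρ.invariants := by
    rw [← h1, mul_invOf_cancel_left]
  rw [Nat.card_eq_fintype_card, Nat.card_eq_fintype_card, ← Fintype.card_prod]
  exact_mod_cast h4

end Traces

/-! ### Splittings over a group algebra and their coinvariants -/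

section Splitting

open Coalgebra

theorem rightHit_mul {k : Type u} {H : Type v} [Field k] [Ring H] [Bialgebra k H]
    (ξ : Module.Dual k H) {x y : H} {ι κ : Type*} (r : Repr k x ι) (t : Repr k y κ) :
    rightHit ξ (x * y) = ∑ i ∈ r.index, ∑ j ∈ t.index,
      ξ (r.right i * t.right j) • (r.left i * t.left j) := by
  simp only [rightHit, LinearMap.comp_apply, Bialgebra.comul_mul, ← r.eq, ← t.eq,
    Finset.sum_mul_sum, map_sum, Algebra.TensorProduct.tmul_mul_tmul]
  simp

theorem leftHit_mul {k : Type u} {H : Type v} [Field k] [Ring H] [Bialgebra k H]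
    (ξ : Module.Dual k H) {x y : H} {ι κ : Type*} (r : Repr k x ι) (t : Repr k y κ) :
    leftHit ξ (x * y) = ∑ i ∈ r.index, ∑ j ∈ t.index,
      ξ (r.left i * t.left j) • (r.right i * t.right j) := by
  simp only [leftHit, LinearMap.comp_apply, Bialgebra.comul_mul, ← r.eq, ← t.eq,
    Finset.sum_mul_sum, map_sum, Algebra.TensorProduct.tmul_mul_tmul]
  simp

/-- A splitting of a Hopf algebra `H` over the group algebra `kG` of a finite group: a Hopf algebra
map `kG → H`, given by the group-like elements `incl g`, and a Hopf algebra map `H → kG` with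
`π ∘ incl = id`, given by its coordinates `π(x) = ∑ coord g x • g`. The fields express that `π`
is comultiplicative, counital, multiplicative and a retraction. -/
structure GroupSplitting (k : Type u) (H : Type v) (G : Type w) [Field k] [Ring H] [HopfAlgebra k H]
    [Group G] [Fintype G] [DecidableEq G] where
  incl : G →* GroupLike k H
  coord : G → Module.Dual k H
  coord_rightHit : ∀ g h, coord g ∘ₗ rightHit (coord h) = if g = h then coord g else 0
  sum_coord : ∑ g, coord g = counit
  coord_mul : ∀ g x y, coord g (x * y) = ∑ a, coord a x * coord (a⁻¹ * g) y
  coord_incl : ∀ g h, coord g (incl h).val = if g = h then 1 else 0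

namespace GroupSplitting

variable {k : Type u} {H : Type v} {G : Type w} [Field k] [Ring H] [HopfAlgebra k H]
  [Group G] [Fintype G] [DecidableEq G] (s : GroupSplitting k H G)

/-- The group-like element of `H` attached to `g`. -/
def emb (g : G) : H := (s.incl g).val

theorem isGroupLikeElem_emb (g : G) : IsGroupLikeElem k (s.emb g) := (s.incl g).2

@[simp] theorem emb_one : s.emb 1 = 1 := by simp [emb]

theorem emb_mul (g h : G) : s.emb (g * h) = s.emb g * s.emb h := by simp [emb]

@[simp] theorem emb_mul_emb_inv (g : G) : s.emb g * s.emb g⁻¹ = 1 := by simp [← emb_mul]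

@[simp] theorem emb_inv_mul_emb (g : G) : s.emb g⁻¹ * s.emb g = 1 := by simp [← emb_mul]

@[simp] theorem mul_emb_mul_emb_inv (x : H) (g : G) : x * s.emb g * s.emb g⁻¹ = x := by
  simp [mul_assoc]

@[simp] theorem mul_emb_inv_mul_emb (x : H) (g : G) : x * s.emb g⁻¹ * s.emb g = x := by
  simp [mul_assoc]

@[simp] theorem emb_inv_mul_emb_mul (x : H) (g : G) : s.emb g⁻¹ * (s.emb g * x) = x := by
  simp [← mul_assoc]

@[simp] theorem emb_mul_emb_inv_mul (x : H) (g : G) : s.emb g * (s.emb g⁻¹ * x) = x := by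
  simp [← mul_assoc]

@[simp] theorem comul_emb (g : G) : comul (R := k) (s.emb g) = s.emb g ⊗ₜ s.emb g :=
  (s.isGroupLikeElem_emb g).comul_eq_tmul_self

@[simp] theorem counit_emb (g : G) : counit (R := k) (s.emb g) = 1 :=
  (s.isGroupLikeElem_emb g).counit_eq_one

@[simp] theorem antipode_emb (g : G) : HopfAlgebra.antipode k (s.emb g) = s.emb g⁻¹ := by
  simp [emb]

/-- The projection `x ↦ x₁ π_g(x₂)` onto the degree `g` part of the right `kG`-comodule `H`. -/
noncomputable def rdeg (g : G) : H →ₗ[k] H := rightHit (s.coord g)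

/-- The projection `x ↦ π_g(x₁) x₂` onto the degree `g` part of the left `kG`-comodule `H`. -/
noncomputable def ldeg (g : G) : H →ₗ[k] H := leftHit (s.coord g)

theorem sum_rdeg (x : H) : ∑ g, s.rdeg g x = x := by
  have h : ∑ g, s.rdeg g = rightHit (∑ g, s.coord g) := by
    ext y
    simp [rdeg, rightHit_eq_sum _ (ℛ k y), Finset.sum_smul]
    exact Finset.sum_comm
  rw [s.sum_coord, rightHit_counit] at h
  simpa using LinearMap.congr_fun h x

theorem sum_ldeg (x : H) : ∑ g, s.ldeg g x = x := by
  have h : ∑ g, s.ldeg g = leftHit (∑ g, s.coord g) := by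
    ext y
    simp [ldeg, leftHit_eq_sum _ (ℛ k y), Finset.sum_smul]
    exact Finset.sum_comm
  rw [s.sum_coord, leftHit_counit] at h
  simpa using LinearMap.congr_fun h x

theorem rdeg_rdeg (g h : G) (x : H) :
    s.rdeg g (s.rdeg h x) = if g = h then s.rdeg g x else 0 := by
  simp only [rdeg]
  rw [rightHit_rightHit, s.coord_rightHit]
  split_ifs <;> simp [rightHit]

theorem ldeg_ldeg (g h : G) (x : H) :
    s.ldeg g (s.ldeg h x) = if g = h then s.ldeg g x else 0 := by
  simp only [ldeg]
  rw [leftHit_leftHit, comp_leftHit, s.coord_rightHit]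
  by_cases hgh : g = h
  · simp [hgh]
  · simp [hgh, Ne.symm hgh, leftHit]

theorem ldeg_rdeg (g h : G) (x : H) : s.ldeg g (s.rdeg h x) = s.rdeg h (s.ldeg g x) :=
  leftHit_rightHit _ _ x

theorem comul_rdeg (g : G) (x : H) :
    comul (R := k) (s.rdeg g x) = (s.rdeg g).lTensor H (comul x) := comul_rightHit _ x

theorem comul_ldeg (g : G) (x : H) :
    comul (R := k) (s.ldeg g x) = (s.ldeg g).rTensor H (comul x) := comul_leftHit _ x

theorem counit_rdeg (g : G) (x : H) : counit (R := k) (s.rdeg g x) = s.coord g x :=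
  counit_rightHit _ x

theorem counit_ldeg (g : G) (x : H) : counit (R := k) (s.ldeg g x) = s.coord g x :=
  counit_leftHit _ x

theorem rTensor_rdeg_comul (g : G) (x : H) :
    (s.rdeg g).rTensor H (comul x) = (s.ldeg g).lTensor H (comul (R := k) x) :=
  rTensor_rightHit_comul _ x

theorem rdeg_mul (g : G) (x y : H) :
    s.rdeg g (x * y) = ∑ a, s.rdeg a x * s.rdeg (a⁻¹ * g) y := by
  simp only [rdeg]
  rw [rightHit_mul _ (ℛ k x) (ℛ k y)]
  simp only [rightHit_eq_sum _ (ℛ k x), rightHit_eq_sum _ (ℛ k y), Finset.sum_mul_sum]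
  simp only [s.coord_mul, Finset.sum_smul, smul_mul_smul_comm]
  conv_rhs => rw [Finset.sum_comm]
  refine Finset.sum_congr rfl fun i _ => ?_
  rw [Finset.sum_comm]

theorem ldeg_mul (g : G) (x y : H) :
    s.ldeg g (x * y) = ∑ a, s.ldeg a x * s.ldeg (a⁻¹ * g) y := by
  simp only [ldeg]
  rw [leftHit_mul _ (ℛ k x) (ℛ k y)]
  simp only [leftHit_eq_sum _ (ℛ k x), leftHit_eq_sum _ (ℛ k y), Finset.sum_mul_sum]
  simp only [s.coord_mul, Finset.sum_smul, smul_mul_smul_comm]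
  conv_rhs => rw [Finset.sum_comm]
  refine Finset.sum_congr rfl fun i _ => ?_
  rw [Finset.sum_comm]

theorem rdeg_emb (g h : G) : s.rdeg g (s.emb h) = if g = h then s.emb h else 0 := by
  simp only [rdeg]
  rw [(s.isGroupLikeElem_emb h).rightHit, emb, s.coord_incl]
  split_ifs <;> simp

theorem ldeg_emb (g h : G) : s.ldeg g (s.emb h) = if g = h then s.emb h else 0 := by
  simp only [ldeg]
  rw [(s.isGroupLikeElem_emb h).leftHit, emb, s.coord_incl]
  split_ifs <;> simp

theorem rdeg_emb_mul (g h : G) (x : H) :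
    s.rdeg g (s.emb h * x) = s.emb h * s.rdeg (h⁻¹ * g) x := by
  simp [rdeg_mul, rdeg_emb]

theorem ldeg_emb_mul (g h : G) (x : H) :
    s.ldeg g (s.emb h * x) = s.emb h * s.ldeg (h⁻¹ * g) x := by
  simp [ldeg_mul, ldeg_emb]

theorem rdeg_mul_emb (g h : G) (x : H) :
    s.rdeg g (x * s.emb h) = s.rdeg (g * h⁻¹) x * s.emb h := by
  rw [rdeg_mul, Finset.sum_eq_single (g * h⁻¹)]
  · simp [rdeg_emb]
  · intro a _ ha
    rw [rdeg_emb, if_neg, mul_zero]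
    rintro rfl
    exact ha (by group)
  · simp

theorem ldeg_mul_emb (g h : G) (x : H) :
    s.ldeg g (x * s.emb h) = s.ldeg (g * h⁻¹) x * s.emb h := by
  rw [ldeg_mul, Finset.sum_eq_single (g * h⁻¹)]
  · simp [ldeg_emb]
  · intro a _ ha
    rw [ldeg_emb, if_neg, mul_zero]
    rintro rfl
    exact ha (by group)
  · simp

theorem rdeg_one (g : G) : s.rdeg g 1 = if g = 1 then 1 else 0 := by
  simpa using s.rdeg_emb g 1

theorem ldeg_one (g : G) : s.ldeg g 1 = if g = 1 then 1 else 0 := by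
  simpa using s.ldeg_emb g 1

/-- The right coinvariants `R = {x | x₁ ⊗ π(x₂) = x ⊗ 1}` of the splitting. -/
def coinv : Subalgebra k H where
  carrier := {x | s.rdeg 1 x = x}
  mul_mem' := by
    intro x y (hx : _ = x) (hy : _ = y)
    change s.rdeg 1 (x * y) = x * y
    rw [rdeg_mul, ← hx, Finset.sum_eq_single 1]
    · simp [rdeg_rdeg, hy]
    · intro a _ ha
      simp [rdeg_rdeg, ha]
    · simp
  add_mem' := by
    intro x y (hx : _ = x) (hy : _ = y)
    change s.rdeg 1 (x + y) = x + y
    rw [map_add, hx, hy]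
  algebraMap_mem' := by
    intro c
    change s.rdeg 1 (algebraMap k H c) = algebraMap k H c
    rw [Algebra.algebraMap_eq_smul_one, map_smul, rdeg_one, if_pos rfl]

theorem mem_coinv {x : H} : x ∈ s.coinv ↔ s.rdeg 1 x = x := Iff.rfl

theorem rdeg_one_coe (r : s.coinv) : s.rdeg 1 (r : H) = r := r.2

theorem rdeg_coe (g : G) (r : s.coinv) : s.rdeg g (r : H) = if g = 1 then (r : H) else 0 := by
  rw [← s.rdeg_one_coe r, rdeg_rdeg]
  split_ifs with h <;> simp [h]

/-- The component `x ↦ E_g(x) g⁻¹` of the isomorphism `H ≃ R ⊗ kG`, where `E_g` is the projection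
to right degree `g`. -/
noncomputable def component (g : G) : H →ₗ[k] s.coinv :=
  (LinearMap.mulRight k (s.emb g⁻¹) ∘ₗ s.rdeg g).codRestrict (Subalgebra.toSubmodule s.coinv)
    fun x => by
      change s.rdeg 1 (s.rdeg g x * s.emb g⁻¹) = s.rdeg g x * s.emb g⁻¹
      rw [rdeg_mul_emb, rdeg_rdeg]
      simp

theorem coe_component (g : G) (x : H) : (s.component g x : H) = s.rdeg g x * s.emb g⁻¹ := rfl

theorem component_coe (g : G) (r : s.coinv) : s.component g r = if g = 1 then r else 0 := by
  ext
  rw [coe_component, rdeg_coe]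
  split_ifs with h <;> simp [h]

/-- The projection `x ↦ x₁ S(π(x₂))` of `H` onto the coinvariants. -/
noncomputable def toCoinv : H →ₗ[k] s.coinv := ∑ g, s.component g

theorem coe_toCoinv (x : H) : (s.toCoinv x : H) = ∑ g, s.rdeg g x * s.emb g⁻¹ := by
  simp [toCoinv, coe_component]

@[simp] theorem toCoinv_coe (r : s.coinv) : s.toCoinv r = r := by
  simp [toCoinv, component_coe]

theorem toCoinv_mul_emb (x : H) (g : G) : s.toCoinv (x * s.emb g) = s.toCoinv x := by
  ext
  rw [coe_toCoinv, coe_toCoinv]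
  refine Fintype.sum_equiv (Equiv.mulRight g⁻¹) _ _ fun a => ?_
  simp [rdeg_mul_emb, emb_mul, mul_assoc]

theorem toCoinv_rdeg (g : G) (x : H) : (s.toCoinv (s.rdeg g x) : H) = s.rdeg g x * s.emb g⁻¹ := by
  rw [coe_toCoinv, Finset.sum_eq_single g]
  · simp [rdeg_rdeg]
  · intro a _ ha
    simp [rdeg_rdeg, ha]
  · simp

theorem counit_toCoinv (x : H) : counit (R := k) (s.toCoinv x : H) = counit (R := k) x := by
  rw [coe_toCoinv, map_sum]
  conv_rhs => rw [← s.sum_rdeg x, map_sum]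
  simp

/-- The left degree projections restricted to the coinvariants. -/
noncomputable def coinvDeg (g : G) : s.coinv →ₗ[k] s.coinv :=
  (s.ldeg g ∘ₗ (Subalgebra.toSubmodule s.coinv).subtype).codRestrict
    (Subalgebra.toSubmodule s.coinv) fun r => by
      change s.rdeg 1 (s.ldeg g r) = s.ldeg g r
      rw [← ldeg_rdeg, s.rdeg_one_coe]

@[simp] theorem coe_coinvDeg (g : G) (r : s.coinv) : (s.coinvDeg g r : H) = s.ldeg g r := rfl

theorem coinvDeg_coinvDeg (g h : G) (r : s.coinv) :
    s.coinvDeg g (s.coinvDeg h r) = if g = h then s.coinvDeg g r else 0 := by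
  ext
  simp only [coe_coinvDeg, ldeg_ldeg]
  split_ifs <;> simp

theorem sum_coinvDeg (r : s.coinv) : ∑ g, s.coinvDeg g r = r := by
  ext
  simp [sum_ldeg]

theorem coinvDeg_mul (g : G) (r t : s.coinv) :
    s.coinvDeg g (r * t) = ∑ a, s.coinvDeg a r * s.coinvDeg (a⁻¹ * g) t := by
  ext
  simp [ldeg_mul]

/-- The adjoint action `r ↦ g r g⁻¹` of `G` on the coinvariants. -/
noncomputable def conj : G →* Module.End k s.coinv where
  toFun g := (LinearMap.mulRight k (s.emb g⁻¹) ∘ₗ LinearMap.mulLeft k (s.emb g) ∘ₗ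
      (Subalgebra.toSubmodule s.coinv).subtype).codRestrict
    (Subalgebra.toSubmodule s.coinv) fun r => by
      change s.rdeg 1 (s.emb g * r * s.emb g⁻¹) = s.emb g * r * s.emb g⁻¹
      rw [rdeg_mul_emb, rdeg_emb_mul]
      simp [rdeg_one_coe]
  map_one' := by ext; simp
  map_mul' g h := by ext; simp [emb_mul, mul_assoc]

@[simp] theorem coe_conj (g : G) (r : s.coinv) :
    (s.conj g r : H) = s.emb g * r * s.emb g⁻¹ := rfl

theorem toCoinv_conj (g : G) (x : H) :
    s.toCoinv (s.emb g * x * s.emb g⁻¹) = s.conj g (s.toCoinv x) := by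
  rw [toCoinv_mul_emb]
  ext
  rw [coe_conj, coe_toCoinv, coe_toCoinv, Finset.mul_sum, Finset.sum_mul]
  refine Fintype.sum_equiv (Equiv.mulLeft g⁻¹) _ _ fun a => ?_
  simp [rdeg_emb_mul, emb_mul, mul_assoc]

theorem conj_coinvDeg (g h : G) (r : s.coinv) :
    s.conj g (s.coinvDeg h r) = s.coinvDeg (g * h * g⁻¹) (s.conj g r) := by
  ext
  simp [ldeg_emb_mul, ldeg_mul_emb, mul_assoc]

end GroupSplitting

end Splitting

/-! ### Linear maps on tensor products with a group algebra -/

section GroupAlgebra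

variable {k : Type u} {G : Type w} [Field k]

/-- Linear maps on `kG ⊗ V` agree if they agree on the tensors `g ⊗ v`. -/
theorem MonoidAlgebra.tensor_ext {V W : Type*} [AddCommGroup V] [Module k V] [AddCommGroup W]
    [Module k W] {f f' : MonoidAlgebra k G ⊗[k] V →ₗ[k] W}
    (h : ∀ g v, f (MonoidAlgebra.single g 1 ⊗ₜ v) = f' (MonoidAlgebra.single g 1 ⊗ₜ v)) :
    f = f' := by
  refine TensorProduct.ext (MonoidAlgebra.lhom_ext' fun g => LinearMap.ext_ring ?_)
  ext v
  exact h g v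

/-- Linear maps on `V ⊗ kG` agree if they agree on the tensors `v ⊗ g`. -/
theorem MonoidAlgebra.tensor_ext' {V W : Type*} [AddCommGroup V] [Module k V] [AddCommGroup W]
    [Module k W] {f f' : V ⊗[k] MonoidAlgebra k G →ₗ[k] W}
    (h : ∀ v g, f (v ⊗ₜ MonoidAlgebra.single g 1) = f' (v ⊗ₜ MonoidAlgebra.single g 1)) :
    f = f' :=
  TensorProduct.ext (LinearMap.ext fun v => MonoidAlgebra.lhom_ext' fun g =>
    LinearMap.ext_ring (h v g))

theorem MonoidAlgebra.sum_single_same {A G ι : Type*} [Semiring A] (g : G) (S : Finset ι)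
    (f : ι → A) :
    ∑ i ∈ S, MonoidAlgebra.single g (f i) = MonoidAlgebra.single g (∑ i ∈ S, f i) :=
  (map_sum (MonoidAlgebra.lsingle (R := ℕ) g) _ _).symm

end GroupAlgebra

/-! ### The coalgebra and Yetter–Drinfeld module of coinvariants -/

section CoinvariantCoalgebra

open Coalgebra HopfBiproduct

theorem HopfBiproduct.middle_tmul {k : Type*} [Field k] {X B C B' C' Y : Type*}
    [AddCommGroup X] [Module k X] [AddCommGroup B] [Module k B] [AddCommGroup C] [Module k C]
    [AddCommGroup B'] [Module k B'] [AddCommGroup C'] [Module k C'] [AddCommGroup Y] [Module k Y]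
    (f : B ⊗[k] C →ₗ[k] C' ⊗[k] B') (x : X) (b : B) (c : C) (y : Y) :
    middle f ((x ⊗ₜ b) ⊗ₜ (c ⊗ₜ y)) = (TensorProduct.assoc k X C' (B' ⊗[k] Y)).symm
      (x ⊗ₜ TensorProduct.assoc k C' B' Y (f (b ⊗ₜ c) ⊗ₜ y)) := by
  simp [middle]

/-- The coalgebra structure on a linear retract `V` of a coalgebra `C` whose retraction `P` has a
coideal as its kernel: `Δ(v) = P(j(v)₁) ⊗ P(j(v)₂)` for the section `j`. -/
@[reducible]
noncomputable def coalgebraOfRetraction {k C V : Type*} [Field k] [AddCommGroup C] [Module k C]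
    [Coalgebra k C] [AddCommGroup V] [Module k V] (P : C →ₗ[k] V) (j : V →ₗ[k] C)
    (hj : ∀ v, P (j v) = v)
    (hcomul : ∀ c, TensorProduct.map P P (comul (j (P c))) = TensorProduct.map P P (comul c))
    (hcounit : ∀ c, counit (R := k) (j (P c)) = counit (R := k) c) : Coalgebra k V where
  comul := (TensorProduct.map P P ∘ₗ comul) ∘ₗ j
  counit := counit ∘ₗ j
  coassoc := by
    have h1 : ((TensorProduct.map P P ∘ₗ comul) ∘ₗ j) ∘ₗ P = TensorProduct.map P P ∘ₗ comul := by
      ext x; exact hcomul x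
    ext v
    have hl : ∀ t : C ⊗[k] C, TensorProduct.assoc k V V V
        (((TensorProduct.map P P ∘ₗ comul) ∘ₗ j).rTensor V (TensorProduct.map P P t)) =
        TensorProduct.map P (TensorProduct.map P P)
          (TensorProduct.assoc k C C C (comul.rTensor C t)) := by
      intro t
      rw [← LinearMap.comp_apply (LinearMap.rTensor V _), LinearMap.rTensor_comp_map, h1,
        TensorProduct.map_map_assoc, ← LinearMap.comp_apply (TensorProduct.map _ P),
        LinearMap.map_comp_rTensor]
    have hr : ∀ t : C ⊗[k] C,
        ((TensorProduct.map P P ∘ₗ comul) ∘ₗ j).lTensor V (TensorProduct.map P P t) =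
        TensorProduct.map P (TensorProduct.map P P) (comul.lTensor C t) := by
      intro t
      rw [← LinearMap.comp_apply (LinearMap.lTensor V _), LinearMap.lTensor_comp_map, h1,
        ← LinearMap.comp_apply (TensorProduct.map P _), LinearMap.map_comp_lTensor]
    refine (hl _).trans (Eq.trans ?_ (hr _).symm)
    rw [coassoc_apply]
  rTensor_counit_comp_comul := by
    ext v
    have h : ∀ t : C ⊗[k] C, (counit (R := k) ∘ₗ j).rTensor V (TensorProduct.map P P t) =
        P.lTensor k ((counit (R := k)).rTensor C t) := by
      intro t
      rw [← LinearMap.comp_apply (LinearMap.rTensor V _), LinearMap.rTensor_comp_map,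
        ← LinearMap.comp_apply (LinearMap.lTensor k _), LinearMap.lTensor_comp_rTensor]
      congr 2
      ext c
      exact hcounit c
    refine (h _).trans ?_
    rw [rTensor_counit_comul, LinearMap.lTensor_tmul]
    exact congrArg (1 ⊗ₜ[k] ·) (hj v)
  lTensor_counit_comp_comul := by
    ext v
    have h : ∀ t : C ⊗[k] C, (counit (R := k) ∘ₗ j).lTensor V (TensorProduct.map P P t) =
        P.rTensor k ((counit (R := k)).lTensor C t) := by
      intro t
      rw [← LinearMap.comp_apply (LinearMap.lTensor V _), LinearMap.lTensor_comp_map,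
        ← LinearMap.comp_apply (LinearMap.rTensor k _), LinearMap.rTensor_comp_lTensor]
      congr 2
      ext c
      exact hcounit c
    refine (h _).trans ?_
    rw [lTensor_counit_comul, LinearMap.rTensor_tmul]
    exact congrArg (· ⊗ₜ[k] 1) (hj v)

namespace GroupSplitting

variable {k : Type u} {H : Type v} {G : Type w} [Field k] [Ring H] [HopfAlgebra k H]
  [Group G] [Fintype G] [DecidableEq G] (s : GroupSplitting k H G)

/-- The comultiplication of a coinvariant has its right tensor factors in the coinvariants. -/
theorem exists_comul_eq (r : s.coinv) : ∃ (S : Finset (H × H)) (x : H × H → H)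
    (y : H × H → s.coinv), comul (R := k) (r : H) = ∑ i ∈ S, x i ⊗ₜ (y i : H) := by
  refine ⟨(ℛ k (r : H)).index, (ℛ k (r : H)).left,
    fun i => s.component 1 ((ℛ k (r : H)).right i), ?_⟩
  conv_lhs => rw [← s.rdeg_one_coe r, comul_rdeg, ← (ℛ k (r : H)).eq]
  simp [coe_component]

/-- The cotensor relation `E_g(r₁) ⊗ r₂ = r₁ ⊗ F_g(r₂)` between right and left degrees. -/
theorem sum_rdeg_tmul (r : s.coinv) {ι : Type*} {S : Finset ι} {x : ι → H} {y : ι → s.coinv}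
    (h : comul (R := k) (r : H) = ∑ i ∈ S, x i ⊗ₜ (y i : H)) (g : G) :
    ∑ i ∈ S, x i ⊗ₜ[k] s.coinvDeg g (y i) = ∑ i ∈ S, s.rdeg g (x i) ⊗ₜ[k] y i := by
  have h1 := congrArg ((s.toCoinv).lTensor H) (s.rTensor_rdeg_comul g r)
  rw [h] at h1
  simpa [← coe_coinvDeg] using h1.symm

/-- The relation `sum_rdeg_tmul` seen through a bilinear map. -/
theorem sum_rdeg_bilin {W : Type*} [AddCommGroup W] [Module k W] (B : H →ₗ[k] s.coinv →ₗ[k] W)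
    (r : s.coinv) {ι : Type*} {S : Finset ι} {x : ι → H} {y : ι → s.coinv}
    (h : comul (R := k) (r : H) = ∑ i ∈ S, x i ⊗ₜ (y i : H)) (g : G) :
    ∑ i ∈ S, B (x i) (s.coinvDeg g (y i)) = ∑ i ∈ S, B (s.rdeg g (x i)) (y i) := by
  simpa using congrArg (TensorProduct.lift B) (s.sum_rdeg_tmul r h g)

/-- `x ↦ Π(x₁) ⊗ Π(x₂)` for the projection `Π` of `H` onto the coinvariants. -/
noncomputable def preComul : H →ₗ[k] s.coinv ⊗[k] s.coinv :=
  TensorProduct.map s.toCoinv s.toCoinv ∘ₗ comul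

theorem preComul_mul_emb (x : H) (g : G) : s.preComul (x * s.emb g) = s.preComul x := by
  simp only [preComul, LinearMap.comp_apply, Bialgebra.comul_mul, comul_emb, ← (ℛ k x).eq,
    Finset.sum_mul, map_sum, Algebra.TensorProduct.tmul_mul_tmul, TensorProduct.map_tmul,
    toCoinv_mul_emb]

theorem preComul_toCoinv (x : H) : s.preComul (s.toCoinv x : H) = s.preComul x := by
  rw [coe_toCoinv, map_sum]
  simp only [preComul_mul_emb]
  rw [← map_sum, sum_rdeg]

/-- The coalgebra structure of the coinvariants: the quotient of the coalgebra `H` by the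
projection `Π`, so `Δ(r) = Π(r₁) ⊗ Π(r₂) = r₁ S(π(r₂)) ⊗ r₃`. -/
noncomputable instance coinvCoalgebra : Coalgebra k s.coinv :=
  coalgebraOfRetraction s.toCoinv (Subalgebra.toSubmodule s.coinv).subtype s.toCoinv_coe
    s.preComul_toCoinv s.counit_toCoinv

theorem coinv_counit (r : s.coinv) : counit (R := k) r = counit (R := k) (r : H) := rfl

theorem coinv_comul_eq_sum (r : s.coinv) {ι : Type*} {S : Finset ι} {x : ι → H} {y : ι → s.coinv}
    (h : comul (R := k) (r : H) = ∑ i ∈ S, x i ⊗ₜ (y i : H)) :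
    comul (R := k) r = ∑ i ∈ S, s.toCoinv (x i) ⊗ₜ[k] y i := by
  change TensorProduct.map s.toCoinv s.toCoinv (comul (r : H)) = _
  simp [h]

theorem comul_conj_eq (g : G) (r : s.coinv) {ι : Type*} {S : Finset ι} {x : ι → H}
    {y : ι → s.coinv} (h : comul (R := k) (r : H) = ∑ i ∈ S, x i ⊗ₜ (y i : H)) :
    comul (R := k) (s.conj g r : H) =
      ∑ i ∈ S, (s.emb g * x i * s.emb g⁻¹) ⊗ₜ (s.conj g (y i) : H) := by
  simp [h, Finset.mul_sum, Finset.sum_mul]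

theorem comul_coinvDeg_eq (g : G) (r : s.coinv) {ι : Type*} {S : Finset ι} {x : ι → H}
    {y : ι → s.coinv} (h : comul (R := k) (r : H) = ∑ i ∈ S, x i ⊗ₜ (y i : H)) :
    comul (R := k) (s.coinvDeg g r : H) = ∑ i ∈ S, (s.ldeg g (x i)) ⊗ₜ (y i : H) := by
  simp [comul_ldeg, h]

/-- The Yetter–Drinfeld module of coinvariants: `G` acts by conjugation, and `r ↦ π(r₁) ⊗ r₂`
is the coaction. -/
noncomputable def ydModule : YetterDrinfeldModule k (MonoidAlgebra k G) s.coinv where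
  action := MonoidAlgebra.lift k (Module.End k s.coinv) G s.conj
  coaction := ∑ g, TensorProduct.mk k _ _ (MonoidAlgebra.single g 1) ∘ₗ s.coinvDeg g
  coaction_coassoc := by
    ext1 r
    simp [coinvDeg_coinvDeg, TensorProduct.tmul_ite]
  coaction_counit := by
    ext1 r
    simp [sum_coinvDeg]
  compatibility := by
    refine MonoidAlgebra.tensor_ext fun g r => ?_
    simp [conj_coinvDeg, TensorProduct.tmul_sum, TensorProduct.sum_tmul]
    refine Fintype.sum_equiv (MulAut.conj g).toEquiv _ _ fun a => ?_
    simp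

end GroupSplitting

end CoinvariantCoalgebra

/-! ### The antipode of the coinvariants and the structure maps on homogeneous elements -/

section CoinvariantAntipode

open Coalgebra HopfBiproduct

namespace GroupSplitting

variable {k : Type u} {H : Type v} {G : Type w} [Field k] [Ring H] [HopfAlgebra k H]
  [Group G] [Fintype G] [DecidableEq G] (s : GroupSplitting k H G)

/-- The right coaction `x ↦ x₁ ⊗ π(x₂)` as an algebra map into `H ⊗ kG = H[G]`. -/
noncomputable def rightCoaction : H →ₐ[k] MonoidAlgebra H G :=
  AlgHom.ofLinearMap (∑ g, MonoidAlgebra.lsingle g ∘ₗ s.rdeg g)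
    (by simp [rdeg_one, MonoidAlgebra.one_def, apply_ite])
    (fun x y => by
      simp only [LinearMap.sum_apply, LinearMap.comp_apply, MonoidAlgebra.lsingle_apply,
        Finset.sum_mul_sum, MonoidAlgebra.single_mul_single, rdeg_mul, map_sum]
      rw [Finset.sum_comm]
      refine Finset.sum_congr rfl fun a _ => ?_
      refine Fintype.sum_equiv (Equiv.mulLeft a⁻¹) _ _ fun g => ?_
      simp)

/-- The left coaction `x ↦ π(x₁) ⊗ x₂` as an algebra map into `H[G]`. -/
noncomputable def leftCoaction : H →ₐ[k] MonoidAlgebra H G :=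
  AlgHom.ofLinearMap (∑ g, MonoidAlgebra.lsingle g ∘ₗ s.ldeg g)
    (by simp [ldeg_one, MonoidAlgebra.one_def, apply_ite])
    (fun x y => by
      simp only [LinearMap.sum_apply, LinearMap.comp_apply, MonoidAlgebra.lsingle_apply,
        Finset.sum_mul_sum, MonoidAlgebra.single_mul_single, ldeg_mul, map_sum]
      rw [Finset.sum_comm]
      refine Finset.sum_congr rfl fun a _ => ?_
      refine Fintype.sum_equiv (Equiv.mulLeft a⁻¹) _ _ fun g => ?_
      simp)

theorem rightCoaction_apply (x : H) :
    s.rightCoaction x = ∑ g, MonoidAlgebra.single g (s.rdeg g x) := by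
  simp [rightCoaction]

theorem leftCoaction_apply (x : H) :
    s.leftCoaction x = ∑ g, MonoidAlgebra.single g (s.ldeg g x) := by
  simp [leftCoaction]

open WithConv in
/-- The antipode reverses degrees and exchanges left and right: `x ↦ ∑ S(F_g(x)) ⊗ g⁻¹` and the
right coaction precomposed with `S` are both convolution inverse to the right coaction. -/
theorem rdeg_antipode (g : G) (x : H) :
    s.rdeg g (HopfAlgebra.antipode k x) = HopfAlgebra.antipode k (s.ldeg g⁻¹ x) := by
  let V : H →ₗ[k] MonoidAlgebra H G :=
    ∑ g, MonoidAlgebra.lsingle g⁻¹ ∘ₗ HopfAlgebra.antipode k ∘ₗ s.ldeg g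
  have hV : ∀ y, V y = ∑ g, MonoidAlgebra.single g⁻¹ (HopfAlgebra.antipode k (s.ldeg g y)) := by
    simp [V]
  have hinv : toConv s.rightCoaction.toLinearMap * toConv V = 1 := by
    ext x : 2
    rw [(ℛ k x).convMul_apply]
    have h1 : ∀ a b, ∑ i ∈ (ℛ k x).index, s.rdeg a ((ℛ k x).left i) *
          HopfAlgebra.antipode k (s.ldeg b ((ℛ k x).right i)) =
        ∑ i ∈ (ℛ k x).index, (if a = b then s.rdeg a ((ℛ k x).left i) else 0) *
          HopfAlgebra.antipode k ((ℛ k x).right i) := by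
      intro a b
      have h2 := congrArg (TensorProduct.lift ((LinearMap.mul k H).compl₁₂ (s.rdeg a)
        (HopfAlgebra.antipode k))) (s.rTensor_rdeg_comul b x)
      rw [← (ℛ k x).eq] at h2
      simpa [rdeg_rdeg] using h2.symm
    simp only [AlgHom.toLinearMap_apply, rightCoaction_apply, hV,
      Finset.sum_mul_sum, MonoidAlgebra.single_mul_single]
    rw [Finset.sum_comm]
    conv_lhs => enter [2, a]; rw [Finset.sum_comm]
    have h3 : ∀ a b, ∑ i ∈ (ℛ k x).index, MonoidAlgebra.single (a * b⁻¹)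
        (s.rdeg a ((ℛ k x).left i) * HopfAlgebra.antipode k (s.ldeg b ((ℛ k x).right i))) =
        if a = b then MonoidAlgebra.single 1 (∑ i ∈ (ℛ k x).index, s.rdeg a ((ℛ k x).left i) *
          HopfAlgebra.antipode k ((ℛ k x).right i)) else 0 := by
      intro a b
      rw [MonoidAlgebra.sum_single_same, h1]
      split_ifs with h
      · simp [h]
      · simp
    simp only [h3]
    simp only [Finset.sum_ite_eq, Finset.mem_univ, if_true]
    rw [MonoidAlgebra.sum_single_same, Finset.sum_comm]
    simp only [← Finset.sum_mul, sum_rdeg, HopfAlgebra.sum_mul_antipode_eq_algebraMap_counit]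
    rfl
  have h := left_inv_eq_right_inv (AlgHom.comp_antipode_convInverse s.rightCoaction).1 hinv
  have h4 := LinearMap.congr_fun (toConv_injective h) x
  have h5 := congrArg (fun y => MonoidAlgebra.coeff y g) h4
  simp only [LinearMap.comp_apply, AlgHom.toLinearMap_apply, rightCoaction_apply, hV] at h5
  simpa [MonoidAlgebra.coeff_sum, Finsupp.single_apply, inv_eq_iff_eq_inv] using h5

open WithConv in
theorem ldeg_antipode (g : G) (x : H) :
    s.ldeg g (HopfAlgebra.antipode k x) = HopfAlgebra.antipode k (s.rdeg g⁻¹ x) := by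
  let V : H →ₗ[k] MonoidAlgebra H G :=
    ∑ g, MonoidAlgebra.lsingle g⁻¹ ∘ₗ HopfAlgebra.antipode k ∘ₗ s.rdeg g
  have hV : ∀ y, V y = ∑ g, MonoidAlgebra.single g⁻¹ (HopfAlgebra.antipode k (s.rdeg g y)) := by
    simp [V]
  have hinv : toConv V * toConv s.leftCoaction.toLinearMap = 1 := by
    ext x : 2
    rw [(ℛ k x).convMul_apply]
    have h1 : ∀ a b, ∑ i ∈ (ℛ k x).index, HopfAlgebra.antipode k (s.rdeg a ((ℛ k x).left i)) *
          s.ldeg b ((ℛ k x).right i) =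
        ∑ i ∈ (ℛ k x).index, HopfAlgebra.antipode k ((ℛ k x).left i) *
          (if a = b then s.ldeg a ((ℛ k x).right i) else 0) := by
      intro a b
      have h2 := congrArg (TensorProduct.lift ((LinearMap.mul k H).compl₁₂
        (HopfAlgebra.antipode k) (s.ldeg b))) (s.rTensor_rdeg_comul a x)
      rw [← (ℛ k x).eq] at h2
      simp only [map_sum, LinearMap.rTensor_tmul, LinearMap.lTensor_tmul, TensorProduct.lift.tmul,
        LinearMap.compl₁₂_apply, LinearMap.mul_apply', ldeg_ldeg] at h2
      rw [h2]
      refine Finset.sum_congr rfl fun i _ => ?_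
      by_cases hab : a = b
      · simp [hab]
      · simp [hab, Ne.symm hab]
    simp only [AlgHom.toLinearMap_apply, leftCoaction_apply, hV,
      Finset.sum_mul_sum, MonoidAlgebra.single_mul_single]
    rw [Finset.sum_comm]
    conv_lhs => enter [2, a]; rw [Finset.sum_comm]
    have h3 : ∀ a b, ∑ i ∈ (ℛ k x).index, MonoidAlgebra.single (a⁻¹ * b)
        (HopfAlgebra.antipode k (s.rdeg a ((ℛ k x).left i)) * s.ldeg b ((ℛ k x).right i)) =
        if a = b then MonoidAlgebra.single 1 (∑ i ∈ (ℛ k x).index,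
          HopfAlgebra.antipode k ((ℛ k x).left i) * s.ldeg a ((ℛ k x).right i)) else 0 := by
      intro a b
      rw [MonoidAlgebra.sum_single_same, h1]
      split_ifs with h
      · simp [h]
      · simp
    simp only [h3]
    simp only [Finset.sum_ite_eq, Finset.mem_univ, if_true]
    rw [MonoidAlgebra.sum_single_same, Finset.sum_comm]
    simp only [← Finset.mul_sum, sum_ldeg, HopfAlgebra.sum_antipode_mul_eq_algebraMap_counit]
    rfl
  have h := left_inv_eq_right_inv hinv (AlgHom.comp_antipode_convInverse s.leftCoaction).2
  have h4 := LinearMap.congr_fun (toConv_injective h).symm x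
  have h5 := congrArg (fun y => MonoidAlgebra.coeff y g) h4
  simp only [LinearMap.comp_apply, AlgHom.toLinearMap_apply, leftCoaction_apply, hV] at h5
  simpa [MonoidAlgebra.coeff_sum, Finsupp.single_apply, inv_eq_iff_eq_inv] using h5

@[simp] theorem ydModule_act (g : G) (r : s.coinv) :
    s.ydModule.act (MonoidAlgebra.single g 1 ⊗ₜ r) = s.conj g r := by
  simp [YetterDrinfeldModule.act, ydModule]

theorem ydModule_coaction (r : s.coinv) :
    s.ydModule.coaction r = ∑ g, MonoidAlgebra.single g 1 ⊗ₜ s.coinvDeg g r := by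
  simp [ydModule]

@[simp] theorem ydModule_action (g : G) :
    s.ydModule.action (MonoidAlgebra.single g 1) = s.conj g := by
  simp [ydModule]

@[simp] theorem ydModule_tensorAct (g : G) (r t : s.coinv) :
    s.ydModule.tensorAct (MonoidAlgebra.single g 1 ⊗ₜ (r ⊗ₜ t)) = s.conj g r ⊗ₜ s.conj g t := by
  simp [YetterDrinfeldModule.tensorAct]

set_option synthInstance.maxHeartbeats 200000 in
theorem ydModule_tensorCoact (r t : s.coinv) :
    s.ydModule.tensorCoact (r ⊗ₜ t) =
      ∑ a, ∑ b, MonoidAlgebra.single (a * b) 1 ⊗ₜ (s.coinvDeg a r ⊗ₜ s.coinvDeg b t) := by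
  simp [YetterDrinfeldModule.tensorCoact, ydModule_coaction, TensorProduct.tmul_sum,
    TensorProduct.sum_tmul]
  exact Finset.sum_comm

theorem ydModule_braiding (r t : s.coinv) :
    s.ydModule.braiding (r ⊗ₜ t) = ∑ g, s.conj g t ⊗ₜ s.coinvDeg g r := by
  simp [YetterDrinfeldModule.braiding, ydModule_coaction, TensorProduct.sum_tmul]

theorem ydModule_actSwap (g : G) (r : s.coinv) :
    s.ydModule.actSwap (MonoidAlgebra.single g 1 ⊗ₜ r) =
      s.conj g r ⊗ₜ MonoidAlgebra.single g 1 := by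
  simp [YetterDrinfeldModule.actSwap]

theorem ydModule_coactSwap (r : s.coinv) (g : G) :
    s.ydModule.coactSwap (r ⊗ₜ MonoidAlgebra.single g 1) =
      ∑ a, MonoidAlgebra.single (a * g) 1 ⊗ₜ s.coinvDeg a r := by
  simp [YetterDrinfeldModule.coactSwap, ydModule_coaction, TensorProduct.sum_tmul]

/-- The antipode `r ↦ π(r₁) S(r₂)` of the coinvariants. -/
noncomputable def coinvAntipode : s.coinv →ₗ[k] s.coinv :=
  (∑ g, LinearMap.mulLeft k (s.emb g) ∘ₗ HopfAlgebra.antipode k ∘ₗ s.ldeg g ∘ₗ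
    (Subalgebra.toSubmodule s.coinv).subtype).codRestrict (Subalgebra.toSubmodule s.coinv)
    fun r => by
      rw [Subalgebra.mem_toSubmodule, mem_coinv]
      simp [rdeg_emb_mul, rdeg_antipode, ldeg_ldeg]

theorem coe_coinvAntipode (r : s.coinv) : (s.coinvAntipode r : H) =
    ∑ g, s.emb g * HopfAlgebra.antipode k (s.ldeg g r) := by
  exact LinearMap.sum_apply _ _ _

/-- `S_R(Π(x)) = π(x₁) S(x₂)` for every `x` in `H`. -/
theorem coe_coinvAntipode_toCoinv (x : H) : (s.coinvAntipode (s.toCoinv x) : H) =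
    ∑ g, s.emb g * HopfAlgebra.antipode k (s.ldeg g x) := by
  rw [coe_coinvAntipode, coe_toCoinv]
  simp only [map_sum, ldeg_mul_emb, HopfAlgebra.antipode_mul_antidistrib, antipode_emb, inv_inv,
    Finset.mul_sum, ← mul_assoc, ← emb_mul]
  conv_rhs =>
    enter [2, g]
    rw [← s.sum_rdeg (s.ldeg g x), map_sum, Finset.mul_sum]
  rw [Finset.sum_comm]
  conv_rhs => rw [Finset.sum_comm]
  refine Finset.sum_congr rfl fun b _ => ?_
  refine Fintype.sum_equiv (Equiv.mulRight b) _ _ fun a => ?_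
  simp [ldeg_rdeg]

theorem comul_conj (g : G) (r : s.coinv) : comul (R := k) (s.conj g r) =
    TensorProduct.map (s.conj g) (s.conj g) (comul r) := by
  obtain ⟨S, x, y, h⟩ := s.exists_comul_eq r
  rw [s.coinv_comul_eq_sum _ (s.comul_conj_eq g r h), s.coinv_comul_eq_sum r h]
  simp [toCoinv_conj]

/-- The comultiplication of the coinvariants is `kG`-colinear. -/
theorem comul_coinvDeg (g : G) (r : s.coinv) : comul (R := k) (s.coinvDeg g r) =
    ∑ a, TensorProduct.map (s.coinvDeg a) (s.coinvDeg (a⁻¹ * g)) (comul r) := by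
  obtain ⟨S, x, y, h⟩ := s.exists_comul_eq r
  rw [s.coinv_comul_eq_sum _ (s.comul_coinvDeg_eq g r h), s.coinv_comul_eq_sum r h]
  simp only [map_sum, TensorProduct.map_tmul]
  have h1 : ∀ a, ∑ i ∈ S, s.coinvDeg a (s.toCoinv (x i)) ⊗ₜ[k] s.coinvDeg (a⁻¹ * g) (y i) =
      ∑ i ∈ S, s.coinvDeg a (s.toCoinv (s.rdeg (a⁻¹ * g) (x i))) ⊗ₜ[k] y i := fun a =>
    s.sum_rdeg_bilin ((TensorProduct.mk k _ _).comp (s.coinvDeg a ∘ₗ s.toCoinv)) r h (a⁻¹ * g)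
  simp only [h1]
  rw [Finset.sum_comm]
  refine Finset.sum_congr rfl fun i _ => ?_
  rw [← TensorProduct.sum_tmul]
  congr 1
  ext
  simp only [AddSubmonoidClass.coe_finsetSum, coe_coinvDeg, toCoinv_rdeg, ldeg_mul_emb]
  simp only [coe_toCoinv, ldeg_rdeg]
  refine Fintype.sum_equiv ((Equiv.inv G).trans (Equiv.mulRight g)).symm _ _ fun a => ?_
  simp

/-- The projection `Π` onto the coinvariants is multiplicative up to the action:
`Π(x z) = Π(x₁) (π(x₂) ⬝ Π(z))`. -/
theorem toCoinv_mul (x z : H) : s.toCoinv (x * z) =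
    ∑ g, s.toCoinv (s.rdeg g x) * s.conj g (s.toCoinv z) := by
  ext
  simp only [AddSubmonoidClass.coe_finsetSum, Subalgebra.coe_mul, toCoinv_rdeg, coe_conj,
    mul_assoc, emb_inv_mul_emb_mul]
  simp only [coe_toCoinv, rdeg_mul, Finset.sum_mul, Finset.mul_sum]
  rw [Finset.sum_comm]
  refine Finset.sum_congr rfl fun a _ => ?_
  refine Fintype.sum_equiv (Equiv.mulLeft a⁻¹) _ _ fun g => ?_
  simp [mul_assoc, ← emb_mul]

end GroupSplitting

end CoinvariantAntipode

/-! ### The braided Hopf algebra of coinvariants -/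

section CoinvariantHopfAlgebra

open Coalgebra HopfBiproduct

namespace GroupSplitting

variable {k : Type u} {H : Type v} {G : Type w} [Field k] [Ring H] [HopfAlgebra k H]
  [Group G] [Fintype G] [DecidableEq G] (s : GroupSplitting k H G)

theorem coinv_coaction_comul :
    s.ydModule.tensorCoact ∘ₗ comul =
    (comul (R := k) (A := s.coinv)).lTensor (MonoidAlgebra k G) ∘ₗ s.ydModule.coaction := by
  ext1 r
  have h : ∀ t : s.coinv ⊗[k] s.coinv, s.ydModule.tensorCoact t = ∑ g,
      MonoidAlgebra.single g 1 ⊗ₜ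
        ∑ a, TensorProduct.map (s.coinvDeg a) (s.coinvDeg (a⁻¹ * g)) t := by
    intro t
    induction t with
    | zero => simp
    | add a b ha hb => simp only [map_add, ha, hb, Finset.sum_add_distrib, TensorProduct.tmul_add]
    | tmul a b =>
      simp only [ydModule_tensorCoact, TensorProduct.tmul_sum, TensorProduct.map_tmul]
      conv_rhs => rw [Finset.sum_comm]
      refine Finset.sum_congr rfl fun a _ => ?_
      refine Fintype.sum_equiv (Equiv.mulLeft a) _ _ fun g => ?_
      simp
  simp only [LinearMap.comp_apply, h, ← comul_coinvDeg, ydModule_coaction, map_sum,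
    LinearMap.lTensor_tmul]

theorem coinv_comul_mul :
    comul ∘ₗ LinearMap.mul' k s.coinv =
    TensorProduct.map (LinearMap.mul' k s.coinv) (LinearMap.mul' k s.coinv) ∘ₗ
      middle s.ydModule.braiding ∘ₗ TensorProduct.map comul comul := by
  refine TensorProduct.ext' fun r t => ?_
  obtain ⟨S, x, y, hr⟩ := s.exists_comul_eq r
  obtain ⟨S', z, w, ht⟩ := s.exists_comul_eq t
  have hrt : comul (R := k) ((r * t : s.coinv) : H) =
      ∑ i ∈ S ×ˢ S', (x i.1 * z i.2) ⊗ₜ ((y i.1 * w i.2 : s.coinv) : H) := by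
    simp [hr, ht, Finset.sum_mul_sum, Finset.sum_product]
  simp only [LinearMap.comp_apply, LinearMap.mul'_apply, TensorProduct.map_tmul]
  rw [s.coinv_comul_eq_sum _ hrt, s.coinv_comul_eq_sum r hr, s.coinv_comul_eq_sum t ht]
  simp only [TensorProduct.sum_tmul, TensorProduct.tmul_sum, map_sum, middle_tmul,
    ydModule_braiding, TensorProduct.assoc_tmul, TensorProduct.assoc_symm_tmul,
    TensorProduct.map_tmul, LinearMap.mul'_apply, Finset.sum_product, toCoinv_mul]
  rw [Finset.sum_comm]
  refine Finset.sum_congr rfl fun j _ => ?_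
  rw [Finset.sum_comm]
  conv_rhs => rw [Finset.sum_comm]
  refine Finset.sum_congr rfl fun g _ => ?_
  exact (s.sum_rdeg_bilin ((TensorProduct.mk k _ _).compl₁₂
    (LinearMap.mulRight k (s.conj g (s.toCoinv (z j))) ∘ₗ s.toCoinv)
    (LinearMap.mulRight k (w j))) r hr g).symm

theorem coinv_antipode_act :
    ∀ (h : MonoidAlgebra k G) (r : s.coinv),
    s.coinvAntipode (s.ydModule.action h r) = s.ydModule.action h (s.coinvAntipode r) := by
  intro a r
  induction a using MonoidAlgebra.induction_linear with
  | zero => simp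
  | add a b ha hb => simp only [map_add, LinearMap.add_apply, ha, hb]
  | single g c =>
    rw [show MonoidAlgebra.single g c = c • MonoidAlgebra.single g (1 : k) by simp, map_smul,
      LinearMap.smul_apply, LinearMap.smul_apply, ydModule_action, map_smul]
    congr 1
    ext
    rw [coe_conj, coe_coinvAntipode, coe_coinvAntipode, Finset.mul_sum, Finset.sum_mul]
    refine Fintype.sum_equiv (MulAut.conj g⁻¹).toEquiv _ _ fun a => ?_
    simp [ldeg_mul_emb, ldeg_emb_mul, HopfAlgebra.antipode_mul_antidistrib, emb_mul, mul_assoc]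

theorem coinv_coaction_antipode :
    s.ydModule.coaction ∘ₗ s.coinvAntipode =
    s.coinvAntipode.lTensor (MonoidAlgebra k G) ∘ₗ s.ydModule.coaction := by
  ext1 r
  simp only [LinearMap.comp_apply, ydModule_coaction, map_sum, LinearMap.lTensor_tmul]
  refine Finset.sum_congr rfl fun g _ => ?_
  congr 1
  ext
  simp only [coe_coinvDeg, coe_coinvAntipode, map_sum, ldeg_emb_mul, ldeg_antipode, ldeg_ldeg,
    ← ldeg_rdeg, rdeg_coe]
  refine Finset.sum_congr rfl fun a _ => ?_
  by_cases h : a = g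
  · simp [h]
  · have h' : ¬ g⁻¹ * a = 1 := fun h1 => h (inv_mul_eq_one.1 h1).symm
    simp [h, h']

theorem coinv_mul_antipode_rTensor_comul :
    LinearMap.mul' k s.coinv ∘ₗ s.coinvAntipode.rTensor s.coinv ∘ₗ comul =
    Algebra.linearMap k s.coinv ∘ₗ counit := by
  ext1 r
  obtain ⟨S, x, y, h⟩ := s.exists_comul_eq r
  ext
  simp only [LinearMap.comp_apply, s.coinv_comul_eq_sum r h, map_sum, LinearMap.rTensor_tmul,
    LinearMap.mul'_apply, AddSubmonoidClass.coe_finsetSum, Subalgebra.coe_mul,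
    coe_coinvAntipode_toCoinv, Finset.sum_mul]
  rw [Finset.sum_comm]
  have h1 : ∀ g, ∑ i ∈ S, s.emb g * HopfAlgebra.antipode k (s.ldeg g (x i)) * (y i : H) =
      s.emb g * algebraMap k H (counit (s.ldeg g (r : H))) := by
    intro g
    rw [← HopfAlgebra.mul_antipode_rTensor_comul_apply, comul_ldeg, h]
    simp [Finset.mul_sum, mul_assoc]
  simp only [h1, counit_ldeg, ← counit_rdeg, rdeg_coe]
  rw [Finset.sum_eq_single 1]
  · simp [coinv_counit]
  · intro g _ hg
    simp [hg]
  · simp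

theorem coinv_mul_antipode_lTensor_comul :
    LinearMap.mul' k s.coinv ∘ₗ s.coinvAntipode.lTensor s.coinv ∘ₗ comul =
    Algebra.linearMap k s.coinv ∘ₗ counit := by
  ext1 r
  obtain ⟨S, x, y, h⟩ := s.exists_comul_eq r
  ext
  simp only [LinearMap.comp_apply, s.coinv_comul_eq_sum r h, map_sum, LinearMap.lTensor_tmul,
    LinearMap.mul'_apply, AddSubmonoidClass.coe_finsetSum, Subalgebra.coe_mul,
    coe_coinvAntipode, Finset.mul_sum]
  rw [Finset.sum_comm]
  have h1 : ∀ g, ∑ i ∈ S, (s.toCoinv (x i) : H) *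
        (s.emb g * HopfAlgebra.antipode k (s.ldeg g (y i))) =
      ∑ i ∈ S, s.rdeg g (x i) * HopfAlgebra.antipode k (y i : H) := by
    intro g
    have := s.sum_rdeg_bilin ((LinearMap.mul k H).compl₁₂
      ((Subalgebra.toSubmodule s.coinv).subtype ∘ₗ s.toCoinv)
      (LinearMap.mulLeft k (s.emb g) ∘ₗ HopfAlgebra.antipode k ∘ₗ
        (Subalgebra.toSubmodule s.coinv).subtype)) r h g
    refine this.trans (Finset.sum_congr rfl fun i _ => ?_)
    change (s.toCoinv (s.rdeg g (x i)) : H) * (s.emb g * _) = _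
    rw [toCoinv_rdeg, mul_assoc, emb_inv_mul_emb_mul]
    rfl
  simp only [h1]
  rw [Finset.sum_comm]
  simp only [← Finset.sum_mul, sum_rdeg]
  have h2 := HopfAlgebra.mul_antipode_lTensor_comul_apply (R := k) (r : H)
  rw [h] at h2
  simpa [coinv_counit] using h2

/-- The coinvariants as a Hopf algebra in the Yetter–Drinfeld modules over `kG`. -/
noncomputable def ydHopfAlgebra : YetterDrinfeldHopfAlgebra k (MonoidAlgebra k G) s.coinv where
  toYetterDrinfeldModule := s.ydModule
  act_mul := by
    refine MonoidAlgebra.tensor_ext fun g t => ?_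
    induction t with
    | zero => simp
    | add a b ha hb => simp only [TensorProduct.tmul_add, map_add, ha, hb]
    | tmul a b => ext; simp [mul_assoc]
  act_one := by
    intro a
    induction a using MonoidAlgebra.induction_linear with
    | zero => simp
    | add a b ha hb => simp only [map_add, LinearMap.add_apply, ha, hb, add_smul]
    | single g c =>
      rw [show MonoidAlgebra.single g c = c • MonoidAlgebra.single g (1 : k) by simp, map_smul,
        LinearMap.smul_apply, ydModule_action]
      ext; simp
  coaction_mul := by
    refine TensorProduct.ext' fun a b => ?_
    simp only [LinearMap.comp_apply, LinearMap.mul'_apply, ydModule_coaction, ydModule_tensorCoact,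
      coinvDeg_mul, TensorProduct.tmul_sum, map_sum, LinearMap.lTensor_tmul]
    rw [Finset.sum_comm]
    refine Finset.sum_congr rfl fun a _ => ?_
    refine Fintype.sum_equiv (Equiv.mulLeft a⁻¹) _ _ fun g => ?_
    simp
  coaction_one := by
    rw [ydModule_coaction, Finset.sum_eq_single 1]
    · congr 1
      ext; simp [ldeg_one]
    · intro g _ hg
      rw [show s.coinvDeg g 1 = 0 by ext; simp [ldeg_one, hg], TensorProduct.tmul_zero]
    · simp
  comul_act := by
    refine MonoidAlgebra.tensor_ext fun g r => ?_
    simp only [LinearMap.comp_apply, ydModule_act, LinearMap.lTensor_tmul, comul_conj]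
    generalize comul (R := k) r = t
    induction t with
    | zero => simp
    | add a b ha hb => simp only [TensorProduct.tmul_add, map_add, ha, hb]
    | tmul a b => simp
  counit_act := by
    intro a r
    induction a using MonoidAlgebra.induction_linear with
    | zero => simp
    | add a b ha hb => simp only [map_add, LinearMap.add_apply, ha, hb, add_mul]
    | single g c =>
      rw [show MonoidAlgebra.single g c = c • MonoidAlgebra.single g (1 : k) by simp, map_smul,
        LinearMap.smul_apply, ydModule_action]
      simp [coinv_counit]
  coaction_comul := s.coinv_coaction_comul
  coaction_counit_right := by
    intro r
    have h : ∀ g, counit (R := k) (s.coinvDeg g r) = if g = 1 then counit (R := k) r else 0 := by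
      intro g
      rw [coinv_counit, coe_coinvDeg, counit_ldeg, ← counit_rdeg, rdeg_coe]
      split_ifs <;> simp [coinv_counit]
    simp [ydModule_coaction, h, MonoidAlgebra.one_def]
  comul_mul := s.coinv_comul_mul
  comul_one := by
    have h : comul (R := k) ((1 : s.coinv) : H) =
        ∑ i ∈ ({()} : Finset Unit), (1 : H) ⊗ₜ ((1 : s.coinv) : H) := by
      simp [Algebra.TensorProduct.one_def]
    rw [s.coinv_comul_eq_sum 1 h]
    simp only [Finset.sum_const, Finset.card_singleton, one_smul]
    exact congrArg (· ⊗ₜ[k] (1 : s.coinv)) (s.toCoinv_coe 1)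
  counit_mul := by
    intro r t
    simp [coinv_counit]
  counit_one := by
    simp [coinv_counit]
  antipode := s.coinvAntipode
  antipode_act := s.coinv_antipode_act
  coaction_antipode := s.coinv_coaction_antipode
  mul_antipode_rTensor_comul := s.coinv_mul_antipode_rTensor_comul
  mul_antipode_lTensor_comul := s.coinv_mul_antipode_lTensor_comul

end GroupSplitting

end CoinvariantHopfAlgebra

/-! ### The biproduct isomorphism and semisimplicity of the coinvariants -/

section BiproductIso

open Coalgebra HopfBiproduct

namespace GroupSplitting

variable {k : Type u} {H : Type v} {G : Type w} [Field k] [Ring H] [HopfAlgebra k H]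
  [Group G] [Fintype G] [DecidableEq G] (s : GroupSplitting k H G)

/-- The inclusion of the group algebra. -/
noncomputable def embAlgHom : MonoidAlgebra k G →ₐ[k] H :=
  MonoidAlgebra.lift k H G ((GroupLike.valMonoidHom k H).comp s.incl)

@[simp] theorem embAlgHom_single (g : G) : s.embAlgHom (MonoidAlgebra.single g 1) = s.emb g := by
  simp [embAlgHom, emb]

theorem component_coe_mul_emb (g h : G) (r : s.coinv) :
    s.component g (r * s.emb h) = if g = h then r else 0 := by
  ext
  rw [coe_component, rdeg_mul_emb, rdeg_coe]
  by_cases hgh : g = h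
  · simp [hgh]
  · simp [hgh, mul_inv_eq_one]

/-- The linear isomorphism `r ⊗ g ↦ r g`, with inverse given by the components. -/
noncomputable def coinvTensorEquiv : s.coinv ⊗[k] MonoidAlgebra k G ≃ₗ[k] H :=
  LinearEquiv.ofLinearMap
    (LinearMap.mul' k H ∘ₗ
      TensorProduct.map s.coinv.val.toLinearMap s.embAlgHom.toLinearMap)
    (∑ g, (TensorProduct.mk k _ _).flip (MonoidAlgebra.single g 1) ∘ₗ s.component g)
    (by
      ext x
      simp [coe_component, sum_rdeg])
    (by
      refine TensorProduct.ext (LinearMap.ext fun r => MonoidAlgebra.lhom_ext' fun g =>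
        LinearMap.ext_ring ?_)
      simp [component_coe_mul_emb, TensorProduct.ite_tmul])

@[simp] theorem coinvTensorEquiv_tmul (r : s.coinv) (g : G) :
    s.coinvTensorEquiv (r ⊗ₜ MonoidAlgebra.single g 1) = r * s.emb g := by
  simp [coinvTensorEquiv]

theorem biproductMul_tmul (r t : s.coinv) (g h : G) :
    s.ydHopfAlgebra.biproductMul ((r ⊗ₜ MonoidAlgebra.single g 1) ⊗ₜ
      (t ⊗ₜ MonoidAlgebra.single h 1)) =
      (r * s.conj g t) ⊗ₜ MonoidAlgebra.single (g * h) 1 := by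
  change TensorProduct.map _ _ (middle s.ydModule.actSwap _) = _
  rw [middle_tmul, ydModule_actSwap]
  simp

theorem coinvTensorEquiv_mul (a b : s.coinv ⊗[k] MonoidAlgebra k G) :
    s.coinvTensorEquiv (s.ydHopfAlgebra.biproductMul (a ⊗ₜ b)) =
      s.coinvTensorEquiv a * s.coinvTensorEquiv b := by
  have h : ((TensorProduct.mk k _ _).compr₂ (s.coinvTensorEquiv.toLinearMap ∘ₗ
      s.ydHopfAlgebra.biproductMul)) = (LinearMap.mul k H).compl₁₂
      s.coinvTensorEquiv.toLinearMap s.coinvTensorEquiv.toLinearMap := by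
    refine MonoidAlgebra.tensor_ext' fun r g => MonoidAlgebra.tensor_ext' fun t h => ?_
    simp only [LinearMap.compr₂_apply, TensorProduct.mk_apply, LinearMap.comp_apply,
      biproductMul_tmul, LinearEquiv.coe_coe, coinvTensorEquiv_tmul, LinearMap.compl₁₂_apply,
      LinearMap.mul_apply', Subalgebra.coe_mul, coe_conj, emb_mul, mul_assoc, emb_inv_mul_emb_mul]
  exact LinearMap.congr_fun (LinearMap.congr_fun h a) b

theorem coinvTensorEquiv_comul (r : s.coinv) (g : G) :
    TensorProduct.map s.coinvTensorEquiv.toLinearMap s.coinvTensorEquiv.toLinearMap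
      (s.ydHopfAlgebra.biproductComul (r ⊗ₜ MonoidAlgebra.single g 1)) =
    comul (r * s.emb g : H) := by
  obtain ⟨S, x, y, h⟩ := s.exists_comul_eq r
  change TensorProduct.map _ _ (middle s.ydModule.coactSwap (TensorProduct.map comul comul _)) = _
  simp only [TensorProduct.map_tmul, s.coinv_comul_eq_sum r h, Bialgebra.comul_mul, h, comul_emb,
    MonoidAlgebra.comul_single, CommSemiring.comul_apply, TensorProduct.sum_tmul, map_sum,
    middle_tmul, ydModule_coactSwap, MonoidAlgebra.lsingle_apply, TensorProduct.tmul_sum,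
    TensorProduct.assoc_tmul, TensorProduct.assoc_symm_tmul, LinearEquiv.coe_coe,
    coinvTensorEquiv_tmul, Finset.sum_mul, Algebra.TensorProduct.tmul_mul_tmul, emb_mul]
  have h1 : ∀ a, ∑ i ∈ S, ((s.toCoinv (x i) : H) * (s.emb a * s.emb g)) ⊗ₜ[k]
        ((s.coinvDeg a (y i) : H) * s.emb g) =
      ∑ i ∈ S, (s.rdeg a (x i) * s.emb g) ⊗ₜ[k] ((y i : H) * s.emb g) := by
    intro a
    refine (s.sum_rdeg_bilin ((TensorProduct.mk k H H).compl₁₂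
      (LinearMap.mulRight k (s.emb a * s.emb g) ∘ₗ
        (Subalgebra.toSubmodule s.coinv).subtype ∘ₗ s.toCoinv)
      (LinearMap.mulRight k (s.emb g) ∘ₗ (Subalgebra.toSubmodule s.coinv).subtype))
      r h a).trans (Finset.sum_congr rfl fun i _ => ?_)
    change ((s.toCoinv (s.rdeg a (x i)) : H) * (s.emb a * s.emb g)) ⊗ₜ[k] _ = _
    rw [toCoinv_rdeg, mul_assoc, emb_inv_mul_emb_mul]
    rfl
  rw [Finset.sum_comm]
  simp only [h1]
  rw [Finset.sum_comm]
  refine Finset.sum_congr rfl fun i _ => ?_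
  rw [← TensorProduct.sum_tmul, ← Finset.sum_mul, sum_rdeg]

theorem coinvTensorEquiv_antipode (r : s.coinv) (g : G) :
    s.coinvTensorEquiv (s.ydHopfAlgebra.biproductAntipode (r ⊗ₜ MonoidAlgebra.single g 1)) =
      HopfAlgebra.antipode k (r * s.emb g : H) := by
  change s.coinvTensorEquiv (s.ydHopfAlgebra.biproductMul (TensorProduct.map _ _
    (s.ydModule.coactSwap _))) = _
  have h : ∀ a (t : s.coinv), s.coinvTensorEquiv (s.ydHopfAlgebra.biproductMul
      (TensorProduct.map (TensorProduct.mk k s.coinv (MonoidAlgebra k G) 1 ∘ₗ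
        HopfAlgebra.antipode k) ((TensorProduct.mk k s.coinv (MonoidAlgebra k G)).flip 1 ∘ₗ
          s.ydHopfAlgebra.antipode) (MonoidAlgebra.single a 1 ⊗ₜ t))) =
      s.emb a⁻¹ * s.coinvAntipode t := by
    intro a t
    simp only [TensorProduct.map_tmul, coinvTensorEquiv_mul, LinearMap.comp_apply,
      MonoidAlgebra.antipode_single, CommSemiring.antipode_eq_id, LinearMap.id_apply,
      TensorProduct.mk_apply, LinearMap.flip_apply, MonoidAlgebra.one_def, coinvTensorEquiv_tmul,
      emb_one, mul_one, Subalgebra.coe_one, one_mul]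
    rfl
  have h2 : ∀ a, (s.coinvAntipode (s.coinvDeg a r) : H) =
      s.emb a * HopfAlgebra.antipode k (s.ldeg a (r : H)) := by
    intro a
    rw [coe_coinvAntipode, Finset.sum_eq_single a]
    · simp [ldeg_ldeg]
    · intro b _ hb
      simp [ldeg_ldeg, hb]
    · simp
  rw [ydModule_coactSwap]
  simp only [map_sum, h, h2, mul_inv_rev, emb_mul, mul_assoc, emb_inv_mul_emb_mul]
  rw [← Finset.mul_sum, ← map_sum, sum_ldeg, HopfAlgebra.antipode_mul_antidistrib, antipode_emb]

/-- Radford's theorem for a splitting over a group algebra: `H` is the biproduct of its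
coinvariants with `kG`. -/
noncomputable def biproductIso : s.ydHopfAlgebra.BiproductIso H where
  toLinearEquiv := s.coinvTensorEquiv
  map_mul := TensorProduct.ext' fun a b => s.coinvTensorEquiv_mul a b
  map_one := by simp [MonoidAlgebra.one_def]
  map_comul := MonoidAlgebra.tensor_ext' fun r g => by
    simpa using s.coinvTensorEquiv_comul r g
  map_counit := MonoidAlgebra.tensor_ext' fun r g => by
    simp [YetterDrinfeldHopfAlgebra.biproductCounit, coinv_counit]
  map_antipode := MonoidAlgebra.tensor_ext' fun r g => by
    simpa using s.coinvTensorEquiv_antipode r g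

theorem card_mul_finrank_coinv [FiniteDimensional k H] :
    Nat.card G * Module.finrank k s.coinv = Module.finrank k H := by
  rw [← s.coinvTensorEquiv.finrank_eq, Module.finrank_tensorProduct, mul_comm,
    (MonoidAlgebra.coeffLinearEquiv k).finrank_eq, Module.finrank_finsupp_self,
    Nat.card_eq_fintype_card]

theorem rdeg_one_coe_mul (r : s.coinv) (x : H) : s.rdeg 1 (r * x) = r * s.rdeg 1 x := by
  simp [rdeg_mul, rdeg_coe]

theorem rdeg_one_mul_coe (x : H) (r : s.coinv) : s.rdeg 1 (x * r) = s.rdeg 1 x * r := by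
  simp [rdeg_mul, rdeg_coe, inv_eq_one]

/-- The coinvariants are semisimple: a left ideal `I` generates a left ideal `H I = H e` with
`e` idempotent, and the degree `1` part of `e` is a right identity of `I` lying in `I`. -/
theorem isSemisimpleRing_coinv [IsSemisimpleRing H] : IsSemisimpleRing s.coinv := by
  have hcompl : ∀ I : Ideal s.coinv, ∃ J, IsCompl I J := by
    intro I
    obtain ⟨e, he, hspan⟩ :=
      IsSemisimpleRing.ideal_eq_span_idempotent (Ideal.span ((↑) '' (I : Set s.coinv) : Set H))
    have hmem : ∀ x ∈ Ideal.span ((↑) '' (I : Set s.coinv) : Set H),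
        ∀ z : H, s.component 1 (z * x) ∈ I := by
      intro x hx
      induction hx using Submodule.span_induction with
      | mem x hx =>
        obtain ⟨i, hi, rfl⟩ := hx
        intro z
        have h : s.component 1 (z * i) = s.component 1 z * i := by
          ext
          simp [coe_component, rdeg_one_mul_coe]
        rw [h]
        exact I.mul_mem_left _ hi
      | zero => intro z; simp
      | add x y _ _ hx hy => intro z; rw [mul_add, map_add]; exact I.add_mem (hx z) (hy z)
      | smul a x _ hx => intro z; rw [smul_eq_mul, ← mul_assoc]; exact hx _
    set d := s.component 1 e with hd
    have hdI : d ∈ I := by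
      have := hmem e (hspan ▸ Ideal.mem_span_singleton_self e) 1
      rwa [one_mul] at this
    have hright : ∀ i ∈ I, i * d = i := by
      intro i hi
      have hi' : (i : H) ∈ Ideal.span ({e} : Set H) :=
        hspan ▸ Ideal.subset_span (Set.mem_image_of_mem _ hi)
      obtain ⟨z, hz⟩ := Ideal.mem_span_singleton'.1 hi'
      have hie : (i : H) * e = i := by rw [← hz, mul_assoc, he.eq]
      ext
      rw [Subalgebra.coe_mul, hd, coe_component, inv_one, emb_one, mul_one, ← rdeg_one_coe_mul, hie,
        rdeg_one_coe]
    refine ⟨LinearMap.ker (LinearMap.toSpanSingleton s.coinv s.coinv d), ?_, ?_⟩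
    · rw [Submodule.disjoint_def]
      intro i hi hid
      rw [LinearMap.mem_ker, LinearMap.toSpanSingleton_apply, smul_eq_mul, hright i hi] at hid
      exact hid
    · rw [codisjoint_iff, eq_top_iff]
      intro r _
      refine Submodule.mem_sup.2 ⟨r * d, I.mul_mem_left r hdI, r - r * d, ?_, by abel⟩
      rw [LinearMap.mem_ker, LinearMap.toSpanSingleton_apply, smul_eq_mul, sub_mul, mul_assoc,
        hright d hdI, sub_self]
  exact (isSemisimpleModule_iff s.coinv s.coinv).2 ⟨hcompl⟩

end GroupSplitting

end BiproductIso

/-! ### Splittings from a nondegenerate pairing of group-like elements and characters -/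

section Pairing

variable {k : Type u} {H : Type v} [Field k] [Ring H] [HopfAlgebra k H]

open Coalgebra WithConv

theorem character_apply_mul_inv (f : WithConv (H →ₐ[k] k)) (g : GroupLike k H) :
    f.ofConv g.val * f.ofConv g⁻¹.val = 1 := by
  rw [← map_mul, ← GroupLike.val_mul, mul_inv_cancel, GroupLike.val_one, map_one]

variable {A : Subgroup (GroupLike k H)} {Γ : Subgroup (WithConv (H →ₐ[k] k))}
  [DecidableEq A] [Fintype Γ]

theorem sum_character_groupLike (hsep : ∀ g ∈ A, (∀ f ∈ Γ, f.ofConv g.val = 1) → g = 1) (g : A) :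
    ∑ f : Γ, f.val.ofConv g.val.val = if g = 1 then (Fintype.card Γ : k) else 0 := by
  split_ifs with hg
  · subst hg
    simp
  · obtain ⟨f₀, hf₀, hne⟩ : ∃ f ∈ Γ, f.ofConv g.val.val ≠ 1 := by
      by_contra! h
      exact hg (Subtype.ext (hsep g g.2 h))
    have h1 : ∑ f : Γ, f.val.ofConv g.val.val =
        f₀.ofConv g.val.val * ∑ f : Γ, f.val.ofConv g.val.val := by
      rw [Finset.mul_sum]
      refine (Fintype.sum_equiv (Equiv.mulLeft (⟨f₀, hf₀⟩ : Γ)) _ _ fun f => ?_).symm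
      simp [character_mul_groupLike]
    have h2 : (f₀.ofConv g.val.val - 1) * ∑ f : Γ, f.val.ofConv g.val.val = 0 := by
      rw [sub_mul, one_mul, ← h1, sub_self]
    exact (mul_eq_zero.1 h2).resolve_left (sub_ne_zero.2 hne)

theorem sum_character_inv_mul (hsep : ∀ g ∈ A, (∀ f ∈ Γ, f.ofConv g.val = 1) → g = 1) (g h : A) :
    ∑ f : Γ, f.val.ofConv (g⁻¹).val.val * f.val.ofConv h.val.val =
      if g = h then (Fintype.card Γ : k) else 0 := by
  have := sum_character_groupLike hsep (g⁻¹ * h)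
  simp only [inv_mul_eq_one] at this
  rw [← this]
  refine Finset.sum_congr rfl fun f _ => ?_
  rw [← map_mul]
  rfl

/-- The second orthogonality relation follows from the first, since the character table is a
square matrix. -/
theorem sum_groupLike_character [CharZero k] [Fintype A] [DecidableEq Γ]
    (hsep : ∀ g ∈ A, (∀ f ∈ Γ, f.ofConv g.val = 1) → g = 1)
    (hcard : Fintype.card A = Fintype.card Γ) (f f' : Γ) :
    ∑ g : A, f.val.ofConv g.val.val * f'.val.ofConv (g⁻¹).val.val =
      if f = f' then (Fintype.card Γ : k) else 0 := by
  have hn : (Fintype.card Γ : k) ≠ 0 := Nat.cast_ne_zero.2 Fintype.card_ne_zero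
  let M : Matrix A Γ k := .of fun g f => (Fintype.card Γ : k)⁻¹ * f.val.ofConv (g⁻¹).val.val
  let N : Matrix Γ A k := .of fun f g => f.val.ofConv g.val.val
  have hMN : M * N = 1 := by
    ext g h
    simp only [Matrix.mul_apply, Matrix.of_apply, M, N, mul_assoc, ← Finset.mul_sum]
    rw [sum_character_inv_mul hsep, Matrix.one_apply]
    split_ifs <;> simp [hn]
  have hNM : N * M = 1 := (Matrix.mul_eq_one_comm_of_card_eq _ _ k hcard).1 hMN
  have h := congrFun (congrFun hNM f) f'
  simp only [Matrix.mul_apply, Matrix.of_apply, M, N, Matrix.one_apply] at h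
  have h2 : ∑ g : A, f.val.ofConv g.val.val * f'.val.ofConv (g⁻¹).val.val =
      (Fintype.card Γ : k) * ∑ g : A, f.val.ofConv g.val.val *
        ((Fintype.card Γ : k)⁻¹ * f'.val.ofConv (g⁻¹).val.val) := by
    rw [Finset.mul_sum]
    refine Finset.sum_congr rfl fun g _ => ?_
    field_simp
  rw [h2, h]
  split_ifs <;> simp

/-- A group of group-like elements and a group of characters of the same order, with no nontrivial
element of the first killed by all of the second, split `H` over the group algebra of the first:
the coordinates of the projection are the Fourier transforms `|Γ|⁻¹ ∑ f(g⁻¹) f`. -/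
noncomputable def GroupSplitting.ofPairing [CharZero k] [Fintype A]
    (hsep : ∀ g ∈ A, (∀ f ∈ Γ, f.ofConv g.val = 1) → g = 1)
    (hcard : Fintype.card A = Fintype.card Γ) : GroupSplitting k H A :=
  have hn : (Fintype.card Γ : k) ≠ 0 := Nat.cast_ne_zero.2 Fintype.card_ne_zero
  { incl := A.subtype
    coord := fun g => (Fintype.card Γ : k)⁻¹ •
      ∑ f : Γ, f.val.ofConv (g⁻¹).val.val • f.val.ofConv.toLinearMap
    coord_rightHit := fun g h => by
      ext x
      have h1 : ∀ (f : Γ), f.val.ofConv (rightHit ((Fintype.card Γ : k)⁻¹ •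
          ∑ f : Γ, f.val.ofConv (h⁻¹).val.val • f.val.ofConv.toLinearMap) x) =
          (Fintype.card Γ : k)⁻¹ * (f.val.ofConv h.val.val *
            ∑ f' : Γ, f'.val.ofConv (h⁻¹).val.val * f'.val.ofConv x) := by
        intro f
        have h2 : ∑ f' : Γ, f'.val.ofConv (h⁻¹).val.val * f'.val.ofConv x =
            ∑ f' : Γ, (f * f').val.ofConv (h⁻¹).val.val * (f * f').val.ofConv x :=
          (Fintype.sum_equiv (Equiv.mulLeft f) _ _ fun f' => rfl).symm
        rw [h2, rightHit_eq_sum _ (ℛ k x)]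
        simp only [Subgroup.coe_mul, character_mul_groupLike, character_mul_apply _ _ (ℛ k x),
          map_sum, map_smul, Finset.mul_sum, smul_eq_mul, LinearMap.smul_apply,
          LinearMap.sum_apply, Finset.sum_mul, AlgHom.toLinearMap_apply]
        rw [Finset.sum_comm]
        refine Finset.sum_congr rfl fun f' _ => Finset.sum_congr rfl fun i _ => ?_
        have h3 := character_apply_mul_inv f.val h.val
        simp only [InvMemClass.coe_inv]
        linear_combination (-(Fintype.card Γ : k)⁻¹ * f'.val.ofConv (h.val⁻¹).val *
          f'.val.ofConv ((ℛ k x).right i) * f.val.ofConv ((ℛ k x).left i)) * h3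
      have h4 : ((Fintype.card Γ : k)⁻¹ • ∑ f : Γ, f.val.ofConv (g⁻¹).val.val •
          f.val.ofConv.toLinearMap) (rightHit ((Fintype.card Γ : k)⁻¹ •
          ∑ f : Γ, f.val.ofConv (h⁻¹).val.val • f.val.ofConv.toLinearMap) x) =
          (Fintype.card Γ : k)⁻¹ * ((Fintype.card Γ : k)⁻¹ * (∑ f : Γ, f.val.ofConv (g⁻¹).val.val *
            f.val.ofConv h.val.val) *
            ∑ f' : Γ, f'.val.ofConv (h⁻¹).val.val * f'.val.ofConv x) := by
        simp only [LinearMap.smul_apply, LinearMap.sum_apply, AlgHom.toLinearMap_apply, h1,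
          smul_eq_mul]
        congr 1
        generalize ∑ f' : Γ, f'.val.ofConv (h⁻¹).val.val * f'.val.ofConv x = z
        rw [Finset.mul_sum, Finset.sum_mul]
        refine Finset.sum_congr rfl fun f _ => ?_
        ring
      rw [LinearMap.comp_apply, h4, sum_character_inv_mul hsep]
      split_ifs with hgh
      · subst hgh
        simp [hn]
      · simp
    sum_coord := by
      classical
      ext x
      simp only [LinearMap.sum_apply, LinearMap.smul_apply, smul_eq_mul,
        AlgHom.toLinearMap_apply]
      rw [← Finset.mul_sum, Finset.sum_comm]
      have h1 : ∀ f : Γ, ∑ g : A, f.val.ofConv (g⁻¹).val.val * f.val.ofConv x =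
          (if 1 = f then (Fintype.card Γ : k) else 0) * f.val.ofConv x := by
        intro f
        rw [← sum_groupLike_character hsep hcard 1 f, Finset.sum_mul]
        simp
      simp only [h1, ite_mul, zero_mul, Finset.sum_ite_eq, Finset.mem_univ, if_true]
      rw [inv_mul_cancel_left₀ hn]
      rfl
    coord_mul := fun g x y => by
      classical
      simp only [LinearMap.sum_apply, LinearMap.smul_apply, smul_eq_mul,
        AlgHom.toLinearMap_apply, map_mul]
      have h1 : ∀ a : A, (Fintype.card Γ : k)⁻¹ *
            (∑ f : Γ, f.val.ofConv (a⁻¹).val.val * f.val.ofConv x) *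
          ((Fintype.card Γ : k)⁻¹ *
            ∑ f : Γ, f.val.ofConv ((a⁻¹ * g)⁻¹).val.val * f.val.ofConv y) =
          (Fintype.card Γ : k)⁻¹ * ((Fintype.card Γ : k)⁻¹ * ∑ f : Γ, ∑ f' : Γ,
            (f'.val.ofConv a.val.val * f.val.ofConv (a⁻¹).val.val) *
              (f'.val.ofConv (g⁻¹).val.val * (f.val.ofConv x * f'.val.ofConv y))) := by
        intro a
        rw [mul_mul_mul_comm, Finset.sum_mul_sum, mul_assoc]
        congr 2
        refine Finset.sum_congr rfl fun f _ => Finset.sum_congr rfl fun f' _ => ?_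
        have h2 : f'.val.ofConv ((a⁻¹ * g)⁻¹).val.val =
            f'.val.ofConv (g⁻¹).val.val * f'.val.ofConv a.val.val := by
          rw [← map_mul, mul_inv_rev, inv_inv]
          rfl
        rw [h2]
        ring
      simp only [h1, ← Finset.mul_sum]
      congr 1
      rw [Finset.sum_comm]
      have h3 : ∀ f : Γ, ∑ a : A, ∑ f' : Γ,
            (f'.val.ofConv a.val.val * f.val.ofConv (a⁻¹).val.val) *
              (f'.val.ofConv (g⁻¹).val.val * (f.val.ofConv x * f'.val.ofConv y)) =
          (Fintype.card Γ : k) *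
            (f.val.ofConv (g⁻¹).val.val * (f.val.ofConv x * f.val.ofConv y)) := by
        intro f
        rw [Finset.sum_comm]
        simp only [← Finset.sum_mul, sum_groupLike_character hsep hcard, ite_mul, zero_mul,
          Finset.sum_ite_eq', Finset.mem_univ, if_true]
      simp only [h3, ← Finset.mul_sum]
      rw [inv_mul_cancel_left₀ hn]
    coord_incl := fun g h => by
      simp only [LinearMap.sum_apply, LinearMap.smul_apply, smul_eq_mul,
        AlgHom.toLinearMap_apply]
      have := sum_character_inv_mul hsep g h
      change _ * ∑ f : Γ, f.val.ofConv (g⁻¹).val.val * f.val.ofConv h.val.val = _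
      rw [this]
      split_ifs <;> simp [hn] }

end Pairing

/-! ### Semisimple Hopf algebras of dimension `p²q²` -/

theorem theorem2p6 {k : Type u} [Field k] [IsAlgClosed k] [CharZero k]
    {H : Type v} [Ring H] [HopfAlgebra k H] [FiniteDimensional k H] [IsSemisimpleRing H]
    (p q : ℕ) (hp : p.Prime) (hq : q.Prime) (hpq : p ≠ q)
    (hdim : Module.finrank k H = p ^ 2 * q ^ 2)
    (hgcd : Nat.gcd (Nat.card (GroupLike k H))
      (Nat.card (GroupLike k (Module.Dual k H))) = p ^ 2) :
    ∃ (G : Type v) (_ : Group G) (R : Type v) (_ : Ring R) (_ : Algebra k R) (_ : Coalgebra k R)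
      (D : HopfBiproduct.YetterDrinfeldHopfAlgebra k (MonoidAlgebra k G) R),
      Nat.card G = p ^ 2 ∧ IsSemisimpleRing R ∧ Module.finrank k R = q ^ 2 ∧
      Nonempty (D.BiproductIso H) := by
  classical
  have : Fact p.Prime := ⟨hp⟩
  have hp2 : p ^ 2 ≠ 0 := pow_ne_zero 2 hp.ne_zero
  have hfin : Finite (GroupLike k H) := (linearIndep_groupLikeVal (R := k) (A := H)).finite
  have hfin' : Finite (GroupLike k (Module.Dual k H)) :=
    (linearIndep_groupLikeVal (R := k) (A := Module.Dual k H)).finite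
  have hfin'' : Finite (WithConv (H →ₐ[k] k)) := Finite.of_equiv _ groupLikeDualEquiv
  obtain ⟨A, hA⟩ := Sylow.exists_subgroup_card_pow_prime (G := GroupLike k H) p (n := 2)
    (hgcd ▸ Nat.gcd_dvd_left _ _)
  obtain ⟨Γ, hΓ⟩ := Sylow.exists_subgroup_card_pow_prime (G := WithConv (H →ₐ[k] k)) p (n := 2) (by
    rw [← Nat.card_congr (groupLikeDualEquiv (k := k) (H := H)), ← hgcd]
    exact Nat.gcd_dvd_right _ _)
  -- The group-likes in `A` killed by `Γ` have order dividing both `q ^ 2` and `p ^ 2`.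
  have hsep : ∀ g ∈ A, (∀ f ∈ Γ, f.ofConv g.val = 1) → g = 1 := by
    let N : Subgroup (GroupLike k H) :=
      { carrier := {g | g ∈ A ∧ ∀ f ∈ Γ, f.ofConv g.val = 1}
        mul_mem' := fun {a b} ha hb => ⟨A.mul_mem ha.1 hb.1, fun f hf => by
          rw [GroupLike.val_mul, map_mul, ha.2 f hf, hb.2 f hf, one_mul]⟩
        one_mem' := ⟨A.one_mem, fun f _ => map_one f.ofConv⟩
        inv_mem' := fun {a} ha => ⟨A.inv_mem ha.1, fun f hf => by
          have := character_apply_mul_inv f a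
          rwa [ha.2 f hf, one_mul] at this⟩ }
    have h1 : Nat.card N * p ^ 2 ∣ q ^ 2 * p ^ 2 := by
      have := card_mul_card_dvd_finrank N Γ fun g hg => hg.2
      rwa [hΓ, hdim, mul_comm (p ^ 2) (q ^ 2)] at this
    have h2 : Nat.card N ∣ q ^ 2 := Nat.dvd_of_mul_dvd_mul_right (Nat.pos_of_ne_zero hp2) h1
    have h3 : Nat.card N ∣ p ^ 2 := hA ▸ Subgroup.card_dvd_of_le (fun g hg => hg.1)
    have h4 : Nat.card N = 1 := Nat.eq_one_of_dvd_coprimes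
      (Nat.Coprime.pow 2 2 ((Nat.coprime_primes hp hq).2 hpq)) h3 h2
    intro g hg hf
    have h5 : g ∈ N := ⟨hg, hf⟩
    rwa [Subgroup.card_eq_one.1 h4, Subgroup.mem_bot] at h5
  have := Fintype.ofFinite A
  have := Fintype.ofFinite Γ
  let s : GroupSplitting k H A := GroupSplitting.ofPairing hsep (by
    rw [← Nat.card_eq_fintype_card, ← Nat.card_eq_fintype_card, hA, hΓ])
  refine ⟨A, inferInstance, s.coinv, inferInstance, inferInstance, inferInstance, s.ydHopfAlgebra,
    hA, s.isSemisimpleRing_coinv, ?_, ⟨s.biproductIso⟩⟩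
  have := s.card_mul_finrank_coinv
  rw [hA, hdim] at this
  exact Nat.eq_of_mul_eq_mul_left (Nat.pos_of_ne_zero hp2) this
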